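/- **Setting.** All categories below are small $\mathbb C$-linear involutive categories with objects $[n]$, $n\ge 0$; write $\mathsf C(m,n)$ for the morphisms $[m]\to[n]$ and $\mathsf C_n=\mathsf C(n,n)$. In the *annular planar rook category* $\mathsf{AP}$, the space $\mathsf{AP}(m,n)$ has as basis the isotopy classes of annular tangles with $m$ inner and $n$ outer marked points, and a distinguished interval $\star$ on each boundary circle; each marked point lies on exactly one string, and a string either joins an inner to an outer point (through string) or ends at a single boundary point (cap or cup); strings do not cross. (Isotopies may rotate the boundary circles, so a full twist is trivial; equivalently, tangles are the partial injections $\{1,\dots,m\}\to\{1,\dots,n\}$ that preserve the cyclic order.) Composition is insertion of annuli, with floating strings removed; $*$ flips a tangle inside out and is conjugate linear. Let $\tau\in\mathsf{AP}_n$ be the one click rotation (inner point $i$ is joined to outer point $i+1$ mod $n$; $\tau=1$ for $n=0$), and let $\alpha_i\in\mathsf{AP}(n,n+1)$, $1\le i\le n+1$, be the tangle with a cup at outer point $i$, the remaining points being joined in order by through strings, so that the inner $\star$ and the outer $\star$ lie in the same region. The *annular GICAR category* $\mathsf{AG}$ is the $\mathbb C$-linear $*$-category generated by $\alpha_i:[n]\to[n+1]$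 ($1\le i\le n+1$) and $\tau:[n]\to[n]$, for all $n\geq 0$, subject to (1) $\alpha_i\alpha_{j-1}=\alpha_j\alpha_i$ and $\alpha_i^*\alpha_j^*=\alpha_{j-1}^*\alpha_i^*$ for $i<j$; (2) $\alpha_i^*\alpha_j=\alpha_{j-1}\alpha_i^*$ if $i<j$, $\alpha_i^*\alpha_i=1$, and $\alpha_i^*\alpha_j=\alpha_j\alpha_{i-1}^*$ if $i>j$; (3) $\tau^*=\tau^{-1}$, $\tau^n=1$ on $[n]$, and $\tau=1$ on $[0]$; (4) $\alpha_i\tau=\tau\alpha_{i-1}$ and $\alpha_i^*\tau=\tau\alpha_{i-1}^*$ whenever $i\ge2$ and both sides are defined. Let $\Psi:\mathsf{AG}\to\mathsf{AP}$ be the $*$-functor that is the identity on objects and sends $\alpha_i,\tau$ to the tangles of the same name. A *Hilbert $\mathsf C$-module* is a linear $*$-functor $V$ from $\mathsf C$ to finite dimensional complex Hilbert spaces, $[n]\mapsto V_n$. It is *irreducible* if it is non-zero and has no submodules other than $0$ and $V$; its *weight* is the least $n$ with $V_n\neq0$. Isomorphisms of Hilbert modules are unitary natural transformations. For $k\ge0$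 let $\mathsf{AI}(k,m)\subset\mathsf{AP}(k,m)$ be the span of the tangles with fewer than $k$ through strings, and $\mathsf{AI}_k=\mathsf{AI}(k,k)$. Let $\omega\in\mathbb C$ with $\omega^k=1$, where $\omega=1$ if $k=0$. For each $k$ let $\operatorname{tr}$ be any faithful (positive) trace on $\mathsf{AP}_k/\mathsf{AI}_k$, extended to $\mathsf{AP}_k$ by the quotient map. Let $V^{k,\omega}_m$ be the eigenspace for $\omega$ of the internal rotation $a\mapsto a\tau$ on $\mathsf{AP}(k,m)/\mathsf{AI}(k,m)$, with the action of $\mathsf{AP}$ by composition and the inner product $\langle a,b\rangle=\operatorname{tr}(b^*a)$. **Proposition.** Whatever faithful traces are chosen: 1. $V^{k,\omega}$ is an irreducible Hilbert $\mathsf{AP}$-module of weight $k$, with $\dim V^{k,\omega}_m=0$ for $m<k$ and $\dim V^{k,\omega}_m=\binom mk$ for $m\ge k$. 2. Every irreducible Hilbert $\mathsf{AP}$-module of weight $k$ is isomorphic to some $V^{k,\omega}$. 3. $V^{k,\omega}\cong V^{k',\omega'}$ only if $(k,\omega)=(k',\omega')$. 4. Every Hilbert $\mathsf{AP}$-module is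 an orthogonal direct sum of submodules each isomorphic to some $V^{k,\omega}$, and the (finite) multiplicity of each $V^{k,\omega}$ is uniquely determined. 5. $\Psi$ is an isomorphism of $*$-categories $\mathsf{AG}\cong\mathsf{AP}$, and the Hilbert $\mathsf{AG}$-modules are classified in the same way: the modules $\Psi^*V^{k,\omega}=V^{k,\omega}\circ\Psi$ are irreducible of weight $k$ and pairwise non-isomorphic, every irreducible Hilbert $\mathsf{AG}$-module of weight $k$ is isomorphic to some $\Psi^*V^{k,\omega}$, and every Hilbert $\mathsf{AG}$-module is an orthogonal direct sum of submodules isomorphic to modules $\Psi^*V^{k,\omega}$, with unique finite multiplicities. -/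

import Mathlib

open scoped ComplexOrder

universe u v

noncomputable section

namespace GICAR

/-! ## Involutive categories with objects `[n]`, `n ≥ 0` -/

/-- A small category with objects `[0], [1], [2], …` and a contravariant involution which is the
identity on objects (no linear structure).  `comp g f` is `g ∘ f`. -/
structure InvolutiveCat where
  Hom : ℕ → ℕ → Type
  one : ∀ n, Hom n n
  comp : ∀ {l m n : ℕ}, Hom m n → Hom l m → Hom l n
  dagger : ∀ {m n : ℕ}, Hom m n → Hom n m
  one_comp : ∀ {m n : ℕ} (f : Hom m n), comp (one n) f = f
  comp_one : ∀ {m n : ℕ} (f : Hom m n), comp f (one m) = f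
  assoc : ∀ {k l m n : ℕ} (h : Hom m n) (g : Hom l m) (f : Hom k l),
    comp (comp h g) f = comp h (comp g f)
  dagger_dagger : ∀ {m n : ℕ} (f : Hom m n), dagger (dagger f) = f
  dagger_comp : ∀ {l m n : ℕ} (g : Hom m n) (f : Hom l m),
    dagger (comp g f) = comp (dagger f) (dagger g)

/-- A small `ℂ`-linear involutive category with objects `[0], [1], [2], …`: the hom spaces are
complex vector spaces, composition (`comp g f` is `g ∘ f`) is bilinear, and the involution
is conjugate linear and contravariant. -/
structure LinearInvolutiveCat where
  Hom : ℕ → ℕ → Type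
  [addCommGroup : ∀ m n, AddCommGroup (Hom m n)]
  [module : ∀ m n, Module ℂ (Hom m n)]
  one : ∀ n, Hom n n
  comp : ∀ {l m n : ℕ}, Hom m n →ₗ[ℂ] Hom l m →ₗ[ℂ] Hom l n
  star : ∀ {m n : ℕ}, Hom m n →ₛₗ[starRingEnd ℂ] Hom n m
  one_comp : ∀ {m n : ℕ} (f : Hom m n), comp (one n) f = f
  comp_one : ∀ {m n : ℕ} (f : Hom m n), comp f (one m) = f
  assoc : ∀ {k l m n : ℕ} (h : Hom m n) (g : Hom l m) (f : Hom k l),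
    comp (comp h g) f = comp h (comp g f)
  star_star : ∀ {m n : ℕ} (f : Hom m n), star (star f) = f
  star_comp : ∀ {l m n : ℕ} (g : Hom m n) (f : Hom l m),
    star (comp g f) = comp (star f) (star g)

attribute [instance] LinearInvolutiveCat.addCommGroup LinearInvolutiveCat.module

namespace InvolutiveCat

variable (S : InvolutiveCat)

/-- Bilinear extension of the composition. -/
def linComp {l m n : ℕ} :
    (S.Hom m n →₀ ℂ) →ₗ[ℂ] (S.Hom l m →₀ ℂ) →ₗ[ℂ] (S.Hom l n →₀ ℂ) :=
  Finsupp.linearCombination ℂ fun g =>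
    Finsupp.linearCombination ℂ fun f => Finsupp.single (S.comp g f) (1 : ℂ)

/-- Conjugate linear extension of the involution. -/
def linStar {m n : ℕ} : (S.Hom m n →₀ ℂ) →ₛₗ[starRingEnd ℂ] (S.Hom n m →₀ ℂ) where
  toFun f := (f.mapRange (starRingEnd ℂ) (map_zero _)).mapDomain S.dagger
  map_add' f g := by
    rw [Finsupp.mapRange_add (fun x y => map_add _ x y), Finsupp.mapDomain_add]
  map_smul' z f := by
    rw [← Finsupp.mapDomain_smul]
    congr 1
    ext a
    simp

@[simp] theorem linComp_single {l m n : ℕ} (g : S.Hom m n) (f : S.Hom l m) (a b : ℂ) :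
    S.linComp (Finsupp.single g a) (Finsupp.single f b) =
      Finsupp.single (S.comp g f) (a * b) := by
  simp [linComp]

@[simp] theorem linStar_single {m n : ℕ} (f : S.Hom m n) (a : ℂ) :
    S.linStar (Finsupp.single f a) = Finsupp.single (S.dagger f) (starRingEnd ℂ a) := by
  simp [linStar, Finsupp.mapDomain_single]

/-- The category of formal `ℂ`-linear combinations of morphisms of `S`. -/
def linearize : LinearInvolutiveCat where
  Hom m n := S.Hom m n →₀ ℂ
  one n := Finsupp.single (S.one n) 1
  comp := S.linComp
  star := S.linStar
  one_comp f := by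
    induction f using Finsupp.induction_linear with
    | zero => simp
    | add f g hf hg => simp [hf, hg]
    | single f a => simp [S.one_comp]
  comp_one f := by
    induction f using Finsupp.induction_linear with
    | zero => simp
    | add f g hf hg => simp [hf, hg]
    | single f a => simp [S.comp_one]
  assoc h g f := by
    induction h using Finsupp.induction_linear with
    | zero => simp
    | add h h' e e' => simp [e, e']
    | single h c =>
      induction g using Finsupp.induction_linear with
      | zero => simp
      | add g g' e e' => simp [e, e']
      | single g b =>
        induction f using Finsupp.induction_linear with
        | zero => simp
        | add f f' e e' => rw [map_add, e, e', map_add, map_add]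
        | single f a => simp [S.assoc, mul_assoc, -Finsupp.single_mul]
  star_star f := by
    induction f using Finsupp.induction_linear with
    | zero => simp
    | add f g hf hg => simp [hf, hg]
    | single f a => simp [S.dagger_dagger]
  star_comp g f := by
    induction g using Finsupp.induction_linear with
    | zero => simp
    | add g g' e e' => simp [e, e']
    | single g b =>
      induction f using Finsupp.induction_linear with
      | zero => simp
      | add f f' e e' => simp [e, e']
      | single f a => simp [S.dagger_comp, mul_comm, -Finsupp.single_mul]

/-- Morphisms of `S.linearize` are finitely supported families of coefficients. -/
def coeffs (m n : ℕ) : S.linearize.Hom m n ≃ₗ[ℂ] (S.Hom m n →₀ ℂ) :=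
  LinearEquiv.refl ℂ (S.Hom m n →₀ ℂ)

/-- A morphism of `S` as a morphism of `S.linearize`. -/
def single {m n : ℕ} (f : S.Hom m n) : S.linearize.Hom m n :=
  (S.coeffs m n).symm (Finsupp.single f 1)

theorem single_one (n : ℕ) : S.single (S.one n) = S.linearize.one n := rfl

theorem comp_single {l m n : ℕ} (g : S.Hom m n) (f : S.Hom l m) :
    S.linearize.comp (S.single g) (S.single f) = S.single (S.comp g f) := by
  have h := S.linComp_single g f 1 1
  rw [one_mul] at h
  exact h

theorem star_single {m n : ℕ} (f : S.Hom m n) :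
    S.linearize.star (S.single f) = S.single (S.dagger f) := by
  have h := S.linStar_single f 1
  rw [map_one] at h
  exact h

theorem linearize_induction {m n : ℕ} {p : S.linearize.Hom m n → Prop} (zero : p 0)
    (add : ∀ a b, p a → p b → p (a + b)) (smul : ∀ (z : ℂ) f, p (z • S.single f))
    (a : S.linearize.Hom m n) : p a := by
  have key : ∀ b : S.Hom m n →₀ ℂ, p ((S.coeffs m n).symm b) := by
    intro b
    induction b using Finsupp.induction_linear with
    | zero => rw [map_zero]; exact zero
    | add f g hf hg => rw [map_add]; exact add _ _ hf hg
    | single f z =>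
      have h := smul z f
      rwa [single, ← map_smul, Finsupp.smul_single, smul_eq_mul, mul_one] at h
  exact key (S.coeffs m n a)

end InvolutiveCat

/-- A `ℂ`-linear `*`-functor which is the identity on objects. -/
structure StarFunctor (C D : LinearInvolutiveCat) where
  map : ∀ {m n : ℕ}, C.Hom m n →ₗ[ℂ] D.Hom m n
  map_one : ∀ n, map (C.one n) = D.one n
  map_comp : ∀ {l m n : ℕ} (g : C.Hom m n) (f : C.Hom l m),
    map (C.comp g f) = D.comp (map g) (map f)
  map_star : ∀ {m n : ℕ} (f : C.Hom m n), map (C.star f) = D.star (map f)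

/-- The functor is an isomorphism of categories (it is the identity on objects). -/
def StarFunctor.IsIso {C D : LinearInvolutiveCat} (F : StarFunctor C D) : Prop :=
  ∀ m n : ℕ, Function.Bijective (F.map : C.Hom m n →ₗ[ℂ] D.Hom m n)

/-! ## Hilbert modules -/

/-- A Hilbert `C`-module: a linear `*`-functor from `C` to finite dimensional complex
Hilbert spaces.  (Mathlib's inner product is conjugate linear in the first variable.) -/
structure HilbertModule (C : LinearInvolutiveCat) where
  space : ℕ → Type u
  [normed : ∀ n, NormedAddCommGroup (space n)]
  [inner : ∀ n, InnerProductSpace ℂ (space n)]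
  [finite : ∀ n, FiniteDimensional ℂ (space n)]
  map : ∀ {m n : ℕ}, C.Hom m n →ₗ[ℂ] space m →ₗ[ℂ] space n
  map_one : ∀ n, map (C.one n) = LinearMap.id
  map_comp : ∀ {l m n : ℕ} (g : C.Hom m n) (f : C.Hom l m),
    map (C.comp g f) = map g ∘ₗ map f
  inner_map : ∀ {m n : ℕ} (c : C.Hom m n) (ξ : space m) (η : space n),
    Inner.inner ℂ (map c ξ) η = Inner.inner ℂ ξ (map (C.star c) η)

attribute [instance] HilbertModule.normed HilbertModule.inner HilbertModule.finite

namespace HilbertModule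

variable {C D : LinearInvolutiveCat}

/-- A submodule of a Hilbert `C`-module. -/
structure Sub (V : HilbertModule.{u} C) where
  space : ∀ n, Submodule ℂ (V.space n)
  map_mem : ∀ {m n : ℕ} (c : C.Hom m n) {ξ : V.space m}, ξ ∈ space m → V.map c ξ ∈ space n

/-- A submodule as a Hilbert module with the restricted inner product. -/
def Sub.toHilbertModule {V : HilbertModule.{u} C} (W : V.Sub) : HilbertModule.{u} C where
  space n := W.space n
  map {m n} :=
    { toFun := fun c => (V.map c).restrict (p := W.space m) (q := W.space n)
        fun _ h => W.map_mem c h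
      map_add' := fun c d => by ext; simp
      map_smul' := fun z c => by ext; simp }
  map_one n := by
    ext
    simp [V.map_one]
  map_comp g f := by
    ext
    simp [V.map_comp]
  inner_map c ξ η := V.inner_map c ξ η

/-- Isomorphisms of Hilbert modules: unitary natural transformations. -/
structure Iso (V : HilbertModule.{u} C) (W : HilbertModule.{v} C) where
  equiv : ∀ n, V.space n ≃ₗᵢ[ℂ] W.space n
  natural : ∀ {m n : ℕ} (c : C.Hom m n) (ξ : V.space m),
    equiv n (V.map c ξ) = W.map c (equiv m ξ)

/-- `V` is non-zero and has no submodules other than `0` and `V`. -/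
def IsIrreducible (V : HilbertModule.{u} C) : Prop :=
  (∃ n, Nontrivial (V.space n)) ∧
    ∀ W : V.Sub, (∀ n, W.space n = ⊥) ∨ (∀ n, W.space n = ⊤)

/-- `V` has weight `k`: the least `n` with `V_n ≠ 0` is `k`. -/
def HasWeight (V : HilbertModule.{u} C) (k : ℕ) : Prop :=
  IsLeast {n | Nontrivial (V.space n)} k

/-- Restriction of a Hilbert `D`-module along a `*`-functor `C → D`. -/
def pullback (F : StarFunctor C D) (V : HilbertModule.{u} D) : HilbertModule.{u} C where
  space := V.space
  map := V.map ∘ₗ F.map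
  map_one n := by simp [F.map_one, V.map_one]
  map_comp g f := by simp [F.map_comp, V.map_comp]
  inner_map c ξ η := by simp [F.map_star, V.inner_map]

end HilbertModule

/-- Given a family `(V s)` of Hilbert `C`-modules, `W` is an orthogonal direct sum of submodules
in which each `V s` occurs, up to isomorphism, `mult s` times. -/
def IsOrthogonalSum {C : LinearInvolutiveCat} {ι : Type} (V : ι → HilbertModule.{u} C)
    (W : HilbertModule.{v} C) (mult : ι → ℕ) : Prop :=
  ∃ X : (Σ s, Fin (mult s)) → W.Sub,
    (∀ p, Nonempty ((X p).toHilbertModule.Iso (V p.1))) ∧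
    (∀ p q, p ≠ q → ∀ n, (X p).space n ⟂ (X q).space n) ∧
    ∀ n, ⨆ p, (X p).space n = ⊤

/-! ## The annular planar rook category -/

/-- Isotopy classes of annular tangles with `m` inner and `n` outer marked points.
The marked points of each circle are numbered `0, 1, …` clockwise, starting at its `⋆`.
A tangle is recorded by its through strings, as the partial injection sending an inner point to
the outer point it is joined to; the remaining inner points carry caps, the remaining
outer points carry cups.  Strings can be drawn in the annulus without
intersections exactly when the partial injection preserves the cyclic order, and then the
isotopy class is determined by the partial injection. -/
@[ext] structure AnnularTangle (m n : ℕ) where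
  strings : Fin m ≃. Fin n
  cyclic : ∀ {i j k : Fin m} {a b c : Fin n},
    strings i = some a → strings j = some b → strings k = some c →
      (sbtw i j k ↔ sbtw a b c)

namespace AnnularTangle

variable {k l m n : ℕ}

/-- The identity tangle. -/
def one (n : ℕ) : AnnularTangle n n where
  strings := PEquiv.refl _
  cyclic hi hj hk := by
    simp only [PEquiv.refl_apply, Option.some.injEq] at hi hj hk
    rw [hi, hj, hk]

/-- Insertion of annuli: strings of `T` are continued by strings of `S`; a string
that is left with one end on the boundary becomes a cap or a cup, and a floating string is
removed. -/
def comp (S : AnnularTangle m n) (T : AnnularTangle l m) : AnnularTangle l n where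
  strings := T.strings.trans S.strings
  cyclic hi hj hk := by
    rw [PEquiv.trans_eq_some] at hi hj hk
    obtain ⟨x, hx, hx'⟩ := hi
    obtain ⟨y, hy, hy'⟩ := hj
    obtain ⟨z, hz, hz'⟩ := hk
    exact (T.cyclic hx hy hz).trans (S.cyclic hx' hy' hz')

/-- Flipping a tangle inside out. -/
def dagger (T : AnnularTangle m n) : AnnularTangle n m where
  strings := T.strings.symm
  cyclic hi hj hk := by
    rw [PEquiv.eq_some_iff] at hi hj hk
    exact (T.cyclic hi hj hk).symm

/-- The number of through strings. -/
def throughStrings (T : AnnularTangle m n) : ℕ :=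
  (Finset.univ.filter fun i => (T.strings i).isSome).card

end AnnularTangle

/-- Annular tangles with insertion and inside-out flip. -/
abbrev tangleCat : InvolutiveCat where
  Hom := AnnularTangle
  one := AnnularTangle.one
  comp := AnnularTangle.comp
  dagger := AnnularTangle.dagger
  one_comp _ := AnnularTangle.ext (PEquiv.trans_refl _)
  comp_one _ := AnnularTangle.ext (PEquiv.refl_trans _)
  assoc _ _ _ := AnnularTangle.ext (PEquiv.trans_assoc _ _ _).symm
  dagger_dagger _ := AnnularTangle.ext (PEquiv.symm_symm _)
  dagger_comp _ _ := AnnularTangle.ext (PEquiv.symm_trans_rev _ _)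

/-- The annular planar rook category. -/
def AP : LinearInvolutiveCat := tangleCat.linearize

/-- The coefficients of a morphism of the annular planar rook category. -/
def coeffs (m n : ℕ) : AP.Hom m n ≃ₗ[ℂ] (AnnularTangle m n →₀ ℂ) := tangleCat.coeffs m n

/-- A tangle as a morphism of the annular planar rook category. -/
def tangle {m n : ℕ} (T : AnnularTangle m n) : AP.Hom m n := tangleCat.single T

theorem coeffs_tangle {m n : ℕ} (T : AnnularTangle m n) :
    coeffs m n (tangle T) = Finsupp.single T 1 := rfl

theorem coe_finRotate' {n : ℕ} (x : Fin n) :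
    (finRotate n x : ℕ) = if (x : ℕ) + 1 = n then 0 else (x : ℕ) + 1 := by
  cases n with
  | zero => exact x.elim0
  | succ n =>
    rw [coe_finRotate]
    simp only [Fin.ext_iff, Fin.val_last, Nat.add_right_cancel_iff]

theorem sbtw_finRotate {n : ℕ} (i j k : Fin n) :
    sbtw i j k ↔ sbtw (finRotate n i) (finRotate n j) (finRotate n k) := by
  simp only [Fin.sbtw_iff, Fin.lt_def, coe_finRotate']
  have hi := i.is_lt
  have hj := j.is_lt
  have hk := k.is_lt
  split_ifs <;> omega

theorem sbtw_succAbove {n : ℕ} (p : Fin (n + 1)) (i j k : Fin n) :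
    sbtw i j k ↔ sbtw (p.succAbove i) (p.succAbove j) (p.succAbove k) := by
  simp only [Fin.sbtw_iff, Fin.succAbove_lt_succAbove_iff]

/-- The one click rotation: inner point `i` is joined to outer point `i + 1` modulo `n`. -/
def rotation (n : ℕ) : AnnularTangle n n where
  strings := (finRotate n).toPEquiv
  cyclic hi hj hk := by
    simp only [Equiv.toPEquiv_apply, Option.some.injEq] at hi hj hk
    subst hi hj hk
    exact sbtw_finRotate _ _ _

/-- The tangle with `n` inner points, `n + 1` outer points, a cup at outer point `p` and all other
points joined by through strings, such that the region of the inner `⋆` is that of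
the outer one. -/
def cupTangle {n : ℕ} (p : Fin (n + 1)) : AnnularTangle n (n + 1) where
  strings :=
    { toFun := fun i => some (p.succAbove i)
      invFun := fun j => Fin.insertNth (α := fun _ => Option (Fin n)) p none some j
      inv := by
        intro i j
        rcases Fin.eq_self_or_eq_succAbove p j with rfl | ⟨j', rfl⟩
        · simp
        · simp [eq_comm] }
  cyclic hi hj hk := by
    change some _ = _ at hi hj hk
    simp only [Option.some.injEq] at hi hj hk
    subst hi hj hk
    exact sbtw_succAbove _ _ _ _

/-! ## The modules `V^{k,ω}` -/

/-- `AI k m`: the span of the tangles in `AP(k, m)` with fewer than `k` through strings. -/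
def AI (k m : ℕ) : Submodule ℂ (AP.Hom k m) :=
  Submodule.span ℂ {a | ∃ T : AnnularTangle k m, T.throughStrings < k ∧ a = tangle T}

/-- A faithful trace on `AP_k / AI_k`, extended to `AP_k` by the quotient map: a linear
functional vanishing on `AI_k`, tracial, and positive and faithful modulo `AI_k`. -/
structure FaithfulTrace (k : ℕ) where
  tr : AP.Hom k k →ₗ[ℂ] ℂ
  tr_ideal : ∀ a ∈ AI k k, tr a = 0
  tr_comm : ∀ a b : AP.Hom k k, tr (AP.comp a b) = tr (AP.comp b a)
  tr_nonneg : ∀ a : AP.Hom k k, 0 ≤ tr (AP.comp (AP.star a) a)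
  tr_faithful : ∀ a : AP.Hom k k, tr (AP.comp (AP.star a) a) = 0 → a ∈ AI k k

namespace AnnularTangle

variable {k l m n : ℕ}

/-- The set of outer points which meet a through string. -/
def range (T : AnnularTangle m n) : Finset (Fin n) :=
  Finset.univ.filter fun j => (T.strings.symm j).isSome

theorem mem_range {T : AnnularTangle m n} {j : Fin n} :
    j ∈ T.range ↔ ∃ i, T.strings i = some j := by
  simp [range, Option.isSome_iff_exists, PEquiv.eq_some_iff]

theorem card_range_le (T : AnnularTangle m n) : T.range.card ≤ T.throughStrings := by
  classical
  have h : ∀ j ∈ T.range, ∃ i, T.strings i = some j := fun j hj => mem_range.1 hj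
  choose f hf using h
  refine Finset.card_le_card_of_injective
    (f := fun j : T.range => (⟨f j j.2, by simp [hf]⟩ :
      {i // i ∈ Finset.univ.filter fun i => (T.strings i).isSome})) fun j j' e => ?_
  have h1 := hf j j.2
  have h2 : f j j.2 = f j' j'.2 := congrArg Subtype.val e
  rw [h2, hf j' j'.2] at h1
  exact Subtype.ext (Option.some.inj h1).symm

theorem throughStrings_eq (T : AnnularTangle m n) : T.throughStrings = T.range.card :=
  le_antisymm (T.dagger.card_range_le) T.card_range_le

theorem throughStrings_dagger (T : AnnularTangle m n) :
    T.dagger.throughStrings = T.throughStrings := (throughStrings_eq T).symm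

theorem throughStrings_comp_le_right (S : AnnularTangle m n) (T : AnnularTangle l m) :
    (S.comp T).throughStrings ≤ T.throughStrings := by
  refine Finset.card_le_card fun i => ?_
  simp only [Finset.mem_filter, Finset.mem_univ, true_and, Option.isSome_iff_exists]
  rintro ⟨c, hc⟩
  obtain ⟨b, hb, -⟩ := (PEquiv.trans_eq_some _ _ _ _).1 hc
  exact ⟨b, hb⟩

theorem throughStrings_comp_le_left (S : AnnularTangle m n) (T : AnnularTangle l m) :
    (S.comp T).throughStrings ≤ S.throughStrings := by
  rw [throughStrings_eq, throughStrings_eq]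
  refine Finset.card_le_card fun j => ?_
  simp only [mem_range]
  rintro ⟨i, hi⟩
  obtain ⟨b, -, hb⟩ := (PEquiv.trans_eq_some _ _ _ _).1 hi
  exact ⟨b, hb⟩

instance : Finite (AnnularTangle m n) := by
  refine Finite.of_injective (fun T => (T.strings : Fin m → Option (Fin n))) fun S T h => ?_
  exact AnnularTangle.ext (PEquiv.ext (congrFun h))

instance : Fintype (AnnularTangle m n) := Fintype.ofFinite _

end AnnularTangle

section AnnularForm

variable {k l m n : ℕ}

theorem hom_induction {p : AP.Hom m n → Prop} (zero : p 0)
    (add : ∀ a b, p a → p b → p (a + b)) (smul : ∀ (z : ℂ) T, p (z • tangle T))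
    (a : AP.Hom m n) : p a :=
  tangleCat.linearize_induction zero add smul a

theorem comp_tangle (S : AnnularTangle m n) (T : AnnularTangle l m) :
    AP.comp (tangle S) (tangle T) = tangle (S.comp T) := tangleCat.comp_single S T

theorem star_tangle (T : AnnularTangle m n) : AP.star (tangle T) = tangle T.dagger :=
  tangleCat.star_single T

theorem tangle_mem_AI {T : AnnularTangle k m} (h : T.throughStrings < k) :
    tangle T ∈ AI k m := Submodule.subset_span ⟨T, h, rfl⟩

theorem comp_mem_AI (c : AP.Hom m n) {a : AP.Hom k m} (ha : a ∈ AI k m) :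
    AP.comp c a ∈ AI k n := by
  induction ha using Submodule.span_induction with
  | zero => rw [map_zero]; exact zero_mem _
  | add a b _ _ ha hb => rw [map_add]; exact add_mem ha hb
  | smul z a _ ha => rw [map_smul]; exact Submodule.smul_mem _ _ ha
  | mem a ha =>
    obtain ⟨T, hT, rfl⟩ := ha
    induction c using hom_induction with
    | zero => rw [map_zero]; exact zero_mem _
    | add a b ha hb => rw [map_add]; exact add_mem ha hb
    | smul z S =>
      rw [map_smul, LinearMap.smul_apply, comp_tangle]
      exact Submodule.smul_mem _ _
        (tangle_mem_AI ((S.throughStrings_comp_le_right T).trans_lt hT))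

theorem mem_AI_comp {a : AP.Hom k m} (ha : a ∈ AI k m) (c : AP.Hom k k) :
    AP.comp a c ∈ AI k m := by
  induction ha using Submodule.span_induction with
  | zero => rw [map_zero]; exact zero_mem _
  | add a b _ _ ha hb => rw [map_add]; exact add_mem ha hb
  | smul z a _ ha => rw [map_smul]; exact Submodule.smul_mem _ _ ha
  | mem a ha =>
    obtain ⟨T, hT, rfl⟩ := ha
    induction c using hom_induction with
    | zero => rw [map_zero]; exact zero_mem _
    | add a b ha hb => rw [map_add]; exact add_mem ha hb
    | smul z S =>
      rw [map_smul, comp_tangle]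
      exact Submodule.smul_mem _ _
        (tangle_mem_AI ((T.throughStrings_comp_le_left S).trans_lt hT))

variable (t : FaithfulTrace k)

/-- The sesquilinear form `tr (a* b)` on `AP(k, m)`. -/
def form (a b : AP.Hom k m) : ℂ := t.tr (AP.comp (AP.star a) b)

theorem tr_star (a : AP.Hom k k) : t.tr (AP.star a) = starRingEnd ℂ (t.tr a) := by
  have key : ∀ x : AP.Hom k k, (t.tr x + t.tr (AP.star x)).im = 0 := by
    intro x
    have h0 := (Complex.le_def.1 (t.tr_nonneg (AP.one k))).2
    have h1 := (Complex.le_def.1 (t.tr_nonneg x)).2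
    have h2 := (Complex.le_def.1 (t.tr_nonneg (AP.one k + x))).2
    have hs : AP.star (AP.one k) = AP.one k := by
      have h := congrArg AP.star (AP.comp_one (AP.star (AP.one k)))
      rwa [AP.star_comp, AP.star_star, AP.comp_one] at h
    rw [map_add, map_add, map_add, hs] at h2
    simp only [LinearMap.add_apply, map_add, AP.comp_one, AP.one_comp, hs, Complex.add_im,
      Complex.zero_im] at h0 h1 h2 ⊢
    linarith
  have h1 := key a
  have h2 := key (Complex.I • a)
  rw [map_smul, LinearMap.map_smulₛₗ, map_smul] at h2
  simp at h1 h2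
  apply Complex.ext
  · simp; linarith
  · simp; linarith

theorem form_symm (a b : AP.Hom k m) : starRingEnd ℂ (form t b a) = form t a b := by
  rw [form, ← tr_star, AP.star_comp, AP.star_star, form]

theorem form_zero_right (a : AP.Hom k m) {b : AP.Hom k m} (hb : b ∈ AI k m) :
    form t a b = 0 := t.tr_ideal _ (comp_mem_AI _ hb)

theorem form_comp (c : AP.Hom m n) (a : AP.Hom k m) (b : AP.Hom k n) :
    form t (AP.comp c a) b = form t a (AP.comp (AP.star c) b) := by
  rw [form, AP.star_comp, AP.assoc, form]

/-- A choice of a tangle with the same outer end points of through strings. -/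
def representative (T : AnnularTangle k m) : AnnularTangle k m :=
  Classical.choose (⟨T, rfl⟩ : ∃ S : AnnularTangle k m, S.range = T.range)

theorem range_representative (T : AnnularTangle k m) : (representative T).range = T.range :=
  Classical.choose_spec (⟨T, rfl⟩ : ∃ S : AnnularTangle k m, S.range = T.range)

theorem representative_eq {S T : AnnularTangle k m} (h : S.range = T.range) :
    representative S = representative T := by
  unfold representative
  congr 1
  simp only [h]

theorem comp_dagger_comp_eq {S T : AnnularTangle k m} (h : S.range = T.range) :
    S.comp (S.dagger.comp T) = T := by
  refine AnnularTangle.ext (PEquiv.ext fun i => ?_)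
  change ((T.strings.trans S.strings.symm).trans S.strings) i = T.strings i
  rw [PEquiv.trans_assoc, PEquiv.symm_trans_self]
  cases hi : T.strings i with
  | none => rw [PEquiv.trans_eq_none]; simp [hi]
  | some j =>
    rw [PEquiv.trans_eq_some]
    refine ⟨j, hi, ?_⟩
    have hj : j ∈ S.range := h ▸ AnnularTangle.mem_range.2 ⟨i, hi⟩
    rw [PEquiv.ofSet_eq_some_self_iff]
    simpa [AnnularTangle.range] using hj

theorem range_eq_of_throughStrings {S T : AnnularTangle k m} (hS : S.throughStrings = k)
    (hT : T.throughStrings = k) (h : k ≤ (S.comp (S.dagger.comp T)).throughStrings) :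
    S.range = T.range := by
  have h1 : (S.comp (S.dagger.comp T)).range ⊆ S.range := by
    intro j
    simp only [AnnularTangle.mem_range]
    rintro ⟨i, hi⟩
    obtain ⟨b, -, hb⟩ := (PEquiv.trans_eq_some _ _ _ _).1 hi
    exact ⟨b, hb⟩
  have h2 : (S.comp (S.dagger.comp T)).range ⊆ T.range := by
    intro j
    simp only [AnnularTangle.mem_range]
    rintro ⟨i, hi⟩
    change ((T.strings.trans S.strings.symm).trans S.strings) i = some j at hi
    rw [PEquiv.trans_assoc, PEquiv.symm_trans_self, PEquiv.trans_eq_some] at hi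
    obtain ⟨b, hb, hb'⟩ := hi
    rw [PEquiv.ofSet_eq_some_iff] at hb'
    exact ⟨i, hb'.1 ▸ hb⟩
  rw [AnnularTangle.throughStrings_eq] at hS hT h
  rw [← Finset.eq_of_subset_of_card_le h1 (hS.trans_le h),
    Finset.eq_of_subset_of_card_le h2 (hT.trans_le h)]

/-- One tangle with `k` through strings for each possible set of outer end points. -/
def representatives (k m : ℕ) : Finset (AnnularTangle k m) :=
  open Classical in
  (Finset.univ.filter fun T : AnnularTangle k m => T.throughStrings = k).image representative

theorem sub_sum_mem_AI (a : AP.Hom k m) :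
    a - ∑ T ∈ representatives k m, AP.comp (tangle T) (AP.comp (AP.star (tangle T)) a)
      ∈ AI k m := by
  classical
  induction a using hom_induction with
  | zero => simp
  | add a b ha hb =>
    have := add_mem ha hb
    simp only [map_add, Finset.sum_add_distrib]
    convert this using 1
    abel
  | smul z A =>
    simp only [map_smul, ← Finset.smul_sum, ← smul_sub]
    refine Submodule.smul_mem _ _ ?_
    have hle : A.throughStrings ≤ k := by
      simpa [AnnularTangle.throughStrings] using
        Finset.card_le_univ (Finset.univ.filter fun i => (A.strings i).isSome)
    rcases hle.lt_or_eq with hA | hA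
    · refine sub_mem (tangle_mem_AI hA) (sum_mem fun T _ => ?_)
      exact comp_mem_AI _ (comp_mem_AI _ (tangle_mem_AI hA))
    · have hmem : representative A ∈ representatives k m :=
        Finset.mem_image.2 ⟨A, by simpa using hA, rfl⟩
      rw [← Finset.add_sum_erase _ _ hmem, ← sub_sub]
      refine sub_mem ?_ (sum_mem fun T hT => ?_)
      · rw [star_tangle, comp_tangle, comp_tangle,
          comp_dagger_comp_eq (range_representative A), sub_self]
        exact zero_mem _
      · rw [star_tangle, comp_tangle, comp_tangle]
        obtain ⟨hne, hT⟩ := Finset.mem_erase.1 hT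
        obtain ⟨B, hB, rfl⟩ := Finset.mem_image.1 hT
        refine tangle_mem_AI (lt_of_not_ge fun h => hne ?_)
        have hB' : (representative B).throughStrings = k := by
          rw [AnnularTangle.throughStrings_eq, range_representative,
            ← AnnularTangle.throughStrings_eq]
          simpa using hB
        have := range_eq_of_throughStrings hB' hA h
        rw [range_representative] at this
        exact representative_eq this

theorem form_self (a : AP.Hom k m) :
    form t a a = ∑ T ∈ representatives k m,
      t.tr (AP.comp (AP.star (AP.comp (AP.star (tangle T)) a))
        (AP.comp (AP.star (tangle T)) a)) := by
  have h := form_zero_right t a (sub_sum_mem_AI a)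
  rw [form, map_sub, map_sub, sub_eq_zero, map_sum, map_sum] at h
  rw [form, h]
  refine Finset.sum_congr rfl fun T _ => ?_
  rw [AP.star_comp, AP.star_star, AP.assoc]

theorem form_self_nonneg (a : AP.Hom k m) : 0 ≤ form t a a := by
  rw [form_self]
  exact Finset.sum_nonneg fun T _ => t.tr_nonneg _

theorem form_definite {a : AP.Hom k m} (h : form t a a = 0) : a ∈ AI k m := by
  rw [form_self, Finset.sum_eq_zero_iff_of_nonneg fun T _ => t.tr_nonneg _] at h
  have h1 := sub_sum_mem_AI a
  have h2 := sum_mem fun T hT => comp_mem_AI (tangle T) (t.tr_faithful _ (h T hT))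
  have := add_mem h1 h2
  rwa [sub_add_cancel] at this

/-- The space `AP(k, m) / AI(k, m)`; the trace determines its inner product below. -/
def QuotientSpace {k : ℕ} (_t : FaithfulTrace k) (m : ℕ) : Type := AP.Hom k m ⧸ AI k m

instance (m : ℕ) : AddCommGroup (QuotientSpace t m) :=
  inferInstanceAs (AddCommGroup (AP.Hom k m ⧸ AI k m))

instance (m : ℕ) : Module ℂ (QuotientSpace t m) :=
  inferInstanceAs (Module ℂ (AP.Hom k m ⧸ AI k m))

/-- The canonical surjection. -/
def mk (m : ℕ) : AP.Hom k m →ₗ[ℂ] QuotientSpace t m := (AI k m).mkQ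

theorem mk_surjective : Function.Surjective (mk t m) := (AI k m).mkQ_surjective

theorem mk_eq_zero {a : AP.Hom k m} : mk t m a = 0 ↔ a ∈ AI k m :=
  Submodule.Quotient.mk_eq_zero _

/-- The action of `AP(m, n)` on the quotients `AP(k, m) / AI(k, m)`. -/
def act (c : AP.Hom m n) : QuotientSpace t m →ₗ[ℂ] QuotientSpace t n :=
  (AI k m).mapQ (AI k n) (AP.comp c) fun _ ha => comp_mem_AI c ha

/-- Internal rotation on `AP(k, m) / AI(k, m)`. -/
def internalRotation (m : ℕ) : Module.End ℂ (QuotientSpace t m) :=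
  (AI k m).mapQ (AI k m) (AP.comp.flip (tangle (rotation k))) fun _ ha => mem_AI_comp ha _

theorem act_mk (c : AP.Hom m n) (a : AP.Hom k m) :
    act t c (mk t m a) = mk t n (AP.comp c a) := rfl

theorem internalRotation_mk (a : AP.Hom k m) :
    internalRotation t m (mk t m a) = mk t m (AP.comp a (tangle (rotation k))) := rfl

theorem act_internalRotation (c : AP.Hom m n) (x : QuotientSpace t m) :
    act t c (internalRotation t m x) = internalRotation t n (act t c x) := by
  obtain ⟨a, rfl⟩ := mk_surjective t x
  rw [internalRotation_mk, act_mk, act_mk, internalRotation_mk, AP.assoc]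

/-- The form `tr (a* b)` on the quotient `AP(k, m) / AI(k, m)`. -/
def quotientForm (x y : QuotientSpace t m) : ℂ :=
  Quotient.liftOn₂' x y (form t) fun a b a' b' ha hb => by
    have ha : a - a' ∈ AI k m := (Submodule.quotientRel_def _).1 ha
    have hb : b - b' ∈ AI k m := (Submodule.quotientRel_def _).1 hb
    have h1 : form t a b = form t a b' := by
      have := form_zero_right t a hb
      rwa [form, map_sub, map_sub, sub_eq_zero] at this
    have h2 : form t b' a = form t b' a' := by
      have := form_zero_right t b' ha
      rwa [form, map_sub, map_sub, sub_eq_zero] at this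
    rw [h1, ← form_symm, h2, form_symm]

theorem quotientForm_mk (a b : AP.Hom k m) :
    quotientForm t (mk t m a) (mk t m b) = form t a b := rfl

/-- The inner product on `AP(k, m) / AI(k, m)` given by a faithful trace. -/
@[reducible] def quotientCore (m : ℕ) : InnerProductSpace.Core ℂ (QuotientSpace t m) where
  inner := quotientForm t
  conj_inner_symm x y := by
    obtain ⟨a, rfl⟩ := mk_surjective t x
    obtain ⟨b, rfl⟩ := mk_surjective t y
    exact form_symm t a b
  re_inner_nonneg x := by
    obtain ⟨a, rfl⟩ := mk_surjective t x
    exact (Complex.le_def.1 (form_self_nonneg t a)).1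
  add_left x y z := by
    obtain ⟨a, rfl⟩ := mk_surjective t x
    obtain ⟨b, rfl⟩ := mk_surjective t y
    obtain ⟨c, rfl⟩ := mk_surjective t z
    rw [← map_add, quotientForm_mk, quotientForm_mk, quotientForm_mk]
    simp only [form, map_add, LinearMap.add_apply]
  smul_left x y z := by
    obtain ⟨a, rfl⟩ := mk_surjective t x
    obtain ⟨b, rfl⟩ := mk_surjective t y
    rw [← map_smul, quotientForm_mk, quotientForm_mk]
    simp only [form, LinearMap.map_smulₛₗ, LinearMap.smul_apply, smul_eq_mul,
      RingHom.id_apply]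
  definite x h := by
    obtain ⟨a, rfl⟩ := mk_surjective t x
    exact (mk_eq_zero t).2 (form_definite t h)

instance (m : ℕ) : NormedAddCommGroup (QuotientSpace t m) :=
  (quotientCore t m).toNormedAddCommGroup

instance (m : ℕ) : InnerProductSpace ℂ (QuotientSpace t m) :=
  InnerProductSpace.ofCore (quotientCore t m).toCore

theorem inner_mk (a b : AP.Hom k m) :
    inner ℂ (mk t m a) (mk t m b) = t.tr (AP.comp (AP.star a) b) := rfl

instance (m : ℕ) : FiniteDimensional ℂ (QuotientSpace t m) :=
  Module.Finite.of_surjective (mk t m ∘ₗ (coeffs k m).symm.toLinearMap)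
    ((mk_surjective t).comp (coeffs k m).symm.surjective)

/-- The eigenspace of internal rotation for `ω`. -/
def rotationEigenspace (ω : ℂ) (m : ℕ) : Submodule ℂ (QuotientSpace t m) :=
  (internalRotation t m).eigenspace ω

theorem act_mem_rotationEigenspace {ω : ℂ} (c : AP.Hom m n) {x : QuotientSpace t m}
    (hx : x ∈ rotationEigenspace t ω m) : act t c x ∈ rotationEigenspace t ω n := by
  have hx := Module.End.mem_eigenspace_iff.1 hx
  refine Module.End.mem_eigenspace_iff.2 ?_
  rw [← act_internalRotation, hx, map_smul]

end AnnularForm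

section CanonicalTrace

variable {k : ℕ}

theorem AnnularTangle.comp_eq_one_iff {S T : AnnularTangle k k} :
    S.comp T = one k ↔ ∀ i, ∃ j, T.strings i = some j ∧ S.strings j = some i := by
  refine ⟨fun h i => ?_, fun h => AnnularTangle.ext (PEquiv.ext fun i => ?_)⟩
  · have : (S.comp T).strings i = some i := by rw [h]; rfl
    exact (PEquiv.trans_eq_some _ _ _ _).1 this
  · exact (PEquiv.trans_eq_some _ _ _ _).2 (h i)

theorem AnnularTangle.comp_eq_one_comm {S T : AnnularTangle k k} (h : S.comp T = one k) :
    T.comp S = one k := by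
  rw [comp_eq_one_iff] at h ⊢
  choose f hf using h
  have hinj : Function.Injective f := fun i i' e => by
    have h1 := (hf i).2
    rw [e, (hf i').2] at h1
    exact (Option.some.inj h1).symm
  intro j
  obtain ⟨i, rfl⟩ := Finite.injective_iff_surjective.1 hinj j
  exact ⟨i, (hf i).2, (hf i).1⟩

theorem AnnularTangle.dagger_comp_eq_one_iff {S T : AnnularTangle k k} :
    S.dagger.comp T = one k ↔ S = T ∧ T.throughStrings = k := by
  rw [comp_eq_one_iff]
  have hd : ∀ i j, S.dagger.strings j = some i ↔ S.strings i = some j :=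
    fun i j => PEquiv.eq_some_iff _
  simp only [hd]
  constructor
  · intro h
    choose f hf using h
    refine ⟨AnnularTangle.ext (PEquiv.ext fun i => (hf i).2.trans (hf i).1.symm), ?_⟩
    simp [throughStrings, fun i => (hf i).1]
  · rintro ⟨rfl, h⟩ i
    have h1 : (Finset.univ.filter fun i => (S.strings i).isSome) = Finset.univ :=
      Finset.eq_univ_of_card _ (by simpa [throughStrings] using h)
    have h2 : (S.strings i).isSome := by simpa using Finset.ext_iff.1 h1 i
    obtain ⟨j, hj⟩ := Option.isSome_iff_exists.1 h2
    exact ⟨j, hj, hj⟩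

/-- The coefficient of the identity. -/
def idCoeff (k : ℕ) : AP.Hom k k →ₗ[ℂ] ℂ :=
  Finsupp.lapply (AnnularTangle.one k) ∘ₗ (coeffs k k).toLinearMap

open Classical in
theorem idCoeff_tangle (T : AnnularTangle k k) :
    idCoeff k (tangle T) = if T = AnnularTangle.one k then 1 else 0 := by
  change (Finsupp.single T (1 : ℂ)) (AnnularTangle.one k) = _
  rw [Finsupp.single_apply]

theorem eq_sum_tangle {m n : ℕ} (a : AP.Hom m n) :
    a = ∑ T, coeffs m n a T • tangle T := by
  apply (coeffs m n).injective
  rw [map_sum]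
  refine (Finsupp.univ_sum_single (coeffs m n a)).symm.trans
    (Finset.sum_congr rfl fun T _ => ?_)
  rw [map_smul]
  rw [coeffs_tangle, Finsupp.smul_single, smul_eq_mul, mul_one]

open Classical in
theorem idCoeff_star_comp_self (a : AP.Hom k k) :
    idCoeff k (AP.comp (AP.star a) a) =
      ∑ T : AnnularTangle k k, if T.throughStrings = k then
        ((‖coeffs k k a T‖ ^ 2 : ℝ) : ℂ) else 0 := by
  conv_lhs => rw [eq_sum_tangle a]
  simp only [map_sum, map_smul, LinearMap.map_smulₛₗ, LinearMap.sum_apply, LinearMap.smul_apply,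
    star_tangle, comp_tangle, idCoeff_tangle, AnnularTangle.dagger_comp_eq_one_iff, smul_eq_mul]
  refine Finset.sum_congr rfl fun T _ => ?_
  rw [Finset.sum_eq_single T]
  · by_cases h : T.throughStrings = k
    · simp only [h, and_self, if_true, mul_one]
      rw [mul_comm, Complex.conj_mul', Complex.ofReal_pow]
    · simp [h]
  · intro S _ hS
    simp [hS]
  · simp

/-- Faithful traces exist: the coefficient of the identity is one. -/
instance (k : ℕ) : Nonempty (FaithfulTrace k) := by
  classical
  refine ⟨⟨idCoeff k, ?_, ?_, ?_, ?_⟩⟩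
  · intro a ha
    induction ha using Submodule.span_induction with
    | zero => exact map_zero _
    | add a b _ _ ha hb => rw [map_add, ha, hb, add_zero]
    | smul z a _ ha => rw [map_smul, ha, smul_zero]
    | mem a ha =>
      obtain ⟨T, hT, rfl⟩ := ha
      rw [idCoeff_tangle, if_neg]
      rintro rfl
      simp [AnnularTangle.throughStrings, AnnularTangle.one] at hT
  · intro a b
    induction a using hom_induction with
    | zero => simp
    | add a a' h h' => simp [h, h']
    | smul z S =>
      induction b using hom_induction with
      | zero => simp
      | add b b' h h' => simp only [map_add, LinearMap.add_apply, h, h']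
      | smul w T =>
        have : S.comp T = AnnularTangle.one k ↔ T.comp S = AnnularTangle.one k :=
          ⟨AnnularTangle.comp_eq_one_comm, AnnularTangle.comp_eq_one_comm⟩
        simp only [map_smul, LinearMap.smul_apply, comp_tangle, idCoeff_tangle, this, smul_eq_mul]
        ring
  · intro a
    rw [idCoeff_star_comp_self]
    refine Finset.sum_nonneg fun T _ => ?_
    split_ifs
    · exact Complex.zero_le_real.2 (sq_nonneg _)
    · exact le_rfl
  · intro a ha
    rw [idCoeff_star_comp_self, Finset.sum_eq_zero_iff_of_nonneg] at ha
    · rw [eq_sum_tangle a]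
      refine sum_mem fun T _ => ?_
      by_cases h : T.throughStrings = k
      · have := ha T (Finset.mem_univ _)
        rw [if_pos h] at this
        have h0 : coeffs k k a T = 0 := by simpa using this
        rw [h0, zero_smul]
        exact zero_mem _
      · refine Submodule.smul_mem _ _ (tangle_mem_AI (lt_of_le_of_ne ?_ h))
        simpa [AnnularTangle.throughStrings] using
          Finset.card_le_univ (Finset.univ.filter fun i => (T.strings i).isSome)
    · intro T _
      split_ifs
      · exact Complex.zero_le_real.2 (sq_nonneg _)
      · exact le_rfl

end CanonicalTrace

/-- A weight `k` together with a `k`-th root of unity `ω`; for `k = 0` the internal rotation is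
trivial and `ω = 1`. -/
@[ext] structure Label where
  k : ℕ
  ω : ℂ
  pow_eq_one : ω ^ k = 1
  eq_one_of_zero : k = 0 → ω = 1

/-- The Hilbert module `V^{k,ω}`: the `ω`-eigenspace of internal rotation
on `AP(k, m) / AI(k, m)`, with the inner product `tr (a* b)`. -/
def simpleModule (t : ∀ k, FaithfulTrace k) (s : Label) : HilbertModule.{0} AP where
  space m := rotationEigenspace (t s.k) s.ω m
  map {m n} :=
    { toFun := fun c => (act (t s.k) c).restrict (p := rotationEigenspace (t s.k) s.ω m)
        (q := rotationEigenspace (t s.k) s.ω n)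
        fun _ hx => act_mem_rotationEigenspace (t s.k) c hx
      map_add' := fun c d => by
        ext ⟨x, hx⟩
        obtain ⟨a, rfl⟩ := mk_surjective (t s.k) x
        simp [act_mk]
      map_smul' := fun z c => by
        ext ⟨x, hx⟩
        obtain ⟨a, rfl⟩ := mk_surjective (t s.k) x
        simp [act_mk] }
  map_one n := by
    ext ⟨x, hx⟩
    obtain ⟨a, rfl⟩ := mk_surjective (t s.k) x
    simp [act_mk, AP.one_comp]
  map_comp g f := by
    ext ⟨x, hx⟩
    obtain ⟨a, rfl⟩ := mk_surjective (t s.k) x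
    simp [act_mk, AP.assoc]
  inner_map c x y := by
    obtain ⟨x, hx⟩ := x
    obtain ⟨y, hy⟩ := y
    obtain ⟨a, rfl⟩ := mk_surjective (t s.k) x
    obtain ⟨b, rfl⟩ := mk_surjective (t s.k) y
    exact form_comp (t s.k) c a b

/-! ## The annular GICAR category -/

/-- Words in the generators `α_i`, `α_i^*`, `τ`, `τ^*`.  The indices of the
generators are numbered from `0`, so that `α i` is `α_{i+1}`; `comp v w` is `v` after `w`. -/
inductive Word : ℕ → ℕ → Type
  | one (n : ℕ) : Word n n
  | comp {l m n : ℕ} (v : Word m n) (w : Word l m) : Word l n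
  | α {n : ℕ} (i : Fin (n + 1)) : Word n (n + 1)
  | αs {n : ℕ} (i : Fin (n + 1)) : Word (n + 1) n
  | τ (n : ℕ) : Word n n
  | τs (n : ℕ) : Word n n

namespace Word

/-- The adjoint of a word. -/
def dagger : ∀ {m n : ℕ}, Word m n → Word n m
  | _, _, one n => one n
  | _, _, comp v w => comp w.dagger v.dagger
  | _, _, α i => αs i
  | _, _, αs i => α i
  | _, _, τ n => τs n
  | _, _, τs n => τ n

/-- Powers of an endomorphism word. -/
def pow {n : ℕ} (w : Word n n) : ℕ → Word n n
  | 0 => one n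
  | r + 1 => comp w (pow w r)

/-- The congruence on words generated by the relations of the annular GICAR category. -/
inductive Rel : ∀ {m n : ℕ}, Word m n → Word m n → Prop
  -- the relations of a category with involution
  | refl {m n : ℕ} (w : Word m n) : Rel w w
  | symm {m n : ℕ} {v w : Word m n} : Rel v w → Rel w v
  | trans {m n : ℕ} {u v w : Word m n} : Rel u v → Rel v w → Rel u w
  | comp {l m n : ℕ} {v v' : Word m n} {w w' : Word l m} :
      Rel v v' → Rel w w' → Rel (comp v w) (comp v' w')
  | dagger {m n : ℕ} {v w : Word m n} : Rel v w → Rel v.dagger w.dagger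
  | one_comp {m n : ℕ} (w : Word m n) : Rel (Word.comp (one n) w) w
  | comp_one {m n : ℕ} (w : Word m n) : Rel (Word.comp w (one m)) w
  | assoc {k l m n : ℕ} (u : Word m n) (v : Word l m) (w : Word k l) :
      Rel (Word.comp (Word.comp u v) w) (Word.comp u (Word.comp v w))
  -- `α_i α_{j-1} = α_j α_i` for `i < j`
  | α_α {n : ℕ} (i j : Fin (n + 1)) (h : i ≤ j) :
      Rel (Word.comp (α i.castSucc) (α j)) (Word.comp (α j.succ) (α i))
  -- `α_i^* α_j^* = α_{j-1}^* α_i^*` for `i < j`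
  | αs_αs {n : ℕ} (i j : Fin (n + 1)) (h : i ≤ j) :
      Rel (Word.comp (αs i) (αs j.succ)) (Word.comp (αs j) (αs i.castSucc))
  -- `α_i^* α_j = α_{j-1} α_i^*` for `i < j`
  | αs_α_lt {n : ℕ} (i j : Fin (n + 1)) (h : i ≤ j) :
      Rel (Word.comp (αs i.castSucc) (α j.succ)) (Word.comp (α j) (αs i))
  -- `α_i^* α_i = 1`
  | αs_α_eq {n : ℕ} (i : Fin (n + 1)) : Rel (Word.comp (αs i) (α i)) (one n)
  -- `α_i^* α_j = α_j α_{i-1}^*` for `i > j`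
  | αs_α_gt {n : ℕ} (i j : Fin (n + 1)) (h : j ≤ i) :
      Rel (Word.comp (αs i.succ) (α j.castSucc)) (Word.comp (α j) (αs i))
  -- `τ^* = τ⁻¹`, `τ^n = 1` on `[n]`, and `τ = 1` on `[0]`
  | τ_τs (n : ℕ) : Rel (Word.comp (τ n) (τs n)) (one n)
  | τs_τ (n : ℕ) : Rel (Word.comp (τs n) (τ n)) (one n)
  | τ_pow (n : ℕ) : Rel (pow (τ n) n) (one n)
  | τ_zero : Rel (τ 0) (one 0)
  -- `α_i τ = τ α_{i-1}` for `i ≥ 2`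
  | α_τ {n : ℕ} (i : Fin n) :
      Rel (Word.comp (α i.succ) (τ n)) (Word.comp (τ (n + 1)) (α i.castSucc))
  -- `α_i^* τ = τ α_{i-1}^*` for `i ≥ 2`
  | αs_τ {n : ℕ} (i : Fin n) :
      Rel (Word.comp (αs i.succ) (τ (n + 1))) (Word.comp (τ n) (αs i.castSucc))

theorem dagger_dagger {m n : ℕ} (w : Word m n) : w.dagger.dagger = w := by
  induction w with
  | comp v w hv hw => simp only [dagger, hv, hw]
  | _ => rfl

/-- Words modulo the relations. -/
def setoid (m n : ℕ) : Setoid (Word m n) where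
  r := Rel
  iseqv := ⟨Rel.refl, Rel.symm, Rel.trans⟩

/-- The tangle represented by a word. -/
def toTangle : ∀ {m n : ℕ}, Word m n → AnnularTangle m n
  | _, _, one n => AnnularTangle.one n
  | _, _, comp v w => v.toTangle.comp w.toTangle
  | _, _, α i => cupTangle i
  | _, _, αs i => (cupTangle i).dagger
  | _, _, τ n => rotation n
  | _, _, τs n => (rotation n).dagger

theorem toTangle_dagger {m n : ℕ} (w : Word m n) : w.dagger.toTangle = w.toTangle.dagger := by
  induction w with
  | comp v w hv hw =>
    simp only [dagger, toTangle, hv, hw]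
    exact (tangleCat.dagger_comp _ _).symm
  | one n => exact AnnularTangle.ext PEquiv.symm_refl.symm
  | _ => rfl

end Word

/-- The category presented by the generators and relations of the annular GICAR category. -/
abbrev wordCat : InvolutiveCat where
  Hom m n := Quotient (Word.setoid m n)
  one n := Quotient.mk _ (Word.one n)
  comp := Quotient.map₂ Word.comp fun _ _ hv _ _ hw => Word.Rel.comp hv hw
  dagger := Quotient.map Word.dagger fun _ _ h => Word.Rel.dagger h
  one_comp := by
    rintro m n ⟨w⟩
    exact Quotient.sound (Word.Rel.one_comp w)
  comp_one := by
    rintro m n ⟨w⟩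
    exact Quotient.sound (Word.Rel.comp_one w)
  assoc := by
    rintro k l m n ⟨u⟩ ⟨v⟩ ⟨w⟩
    exact Quotient.sound (Word.Rel.assoc u v w)
  dagger_dagger := by
    rintro m n ⟨w⟩
    exact congrArg (Quotient.mk _) w.dagger_dagger
  dagger_comp := by
    rintro l m n ⟨v⟩ ⟨w⟩
    rfl

/-- The annular GICAR category. -/
def AG : LinearInvolutiveCat := wordCat.linearize

/-! ## The functor from the annular GICAR category to the annular planar rook category -/

theorem succAbove_castSucc_succAbove {n : ℕ} {i j : Fin (n + 1)} (h : i ≤ j) (x : Fin n) :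
    i.castSucc.succAbove (j.succAbove x) = j.succ.succAbove (i.succAbove x) := by
  simp only [Fin.succAbove, Fin.lt_def, Fin.le_def] at *
  split_ifs <;> simp_all [Fin.ext_iff] <;> omega

theorem succAbove_castSucc_finRotate {n : ℕ} (i : Fin n) (x : Fin n) :
    i.succ.succAbove (finRotate n x) = finRotate (n + 1) (i.castSucc.succAbove x) := by
  apply Fin.ext
  have hi := i.is_lt
  have hx := x.is_lt
  have h : ∀ (p : Fin (n + 1)) (y : Fin n),
      (p.succAbove y : ℕ) = if (y : ℕ) < p then (y : ℕ) else y + 1 := by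
    intro p y
    simp only [Fin.succAbove, Fin.lt_def, Fin.val_castSucc]
    split_ifs <;> simp
  simp only [h, coe_finRotate', Fin.val_succ, Fin.val_castSucc]
  split_ifs <;> omega

theorem finRotate_pow_self (n : ℕ) : finRotate n ^ n = 1 := by
  have key : ∀ (r : ℕ) (x : Fin n), ((finRotate n ^ r) x : ℕ) = (x + r) % n := by
    intro r x
    induction r with
    | zero => simp [Nat.mod_eq_of_lt x.is_lt]
    | succ r ih =>
      rw [pow_succ', Equiv.Perm.mul_apply, coe_finRotate', ih, ← add_assoc]
      have := Nat.mod_lt (x + r : ℕ) x.pos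
      rw [← Nat.mod_add_mod (x + r : ℕ) n 1]
      split_ifs with h
      · rw [h, Nat.mod_self]
      · rw [Nat.mod_eq_of_lt (a := (x + r) % n + 1) (by omega)]
  ext x
  rw [key]
  simp [Nat.mod_eq_of_lt x.is_lt]

theorem cupTangle_comp_cupTangle {n : ℕ} {i j : Fin (n + 1)} (h : i ≤ j) :
    (cupTangle i.castSucc).comp (cupTangle j) = (cupTangle j.succ).comp (cupTangle i) :=
  AnnularTangle.ext (PEquiv.ext fun x => congrArg some (succAbove_castSucc_succAbove h x))

theorem capTangle_comp_cupTangle_lt {n : ℕ} {i j : Fin (n + 1)} (h : i ≤ j) :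
    (cupTangle i.castSucc).dagger.comp (cupTangle j.succ) =
      (cupTangle j).comp (cupTangle i).dagger := by
  refine AnnularTangle.ext (PEquiv.ext fun x => ?_)
  change Fin.insertNth (α := fun _ => Option (Fin (n + 1))) i.castSucc none some
      (j.succ.succAbove x) =
    (Fin.insertNth (α := fun _ => Option (Fin n)) i none some x).bind
      fun y => some (j.succAbove y)
  rcases Fin.eq_self_or_eq_succAbove i x with rfl | ⟨y, rfl⟩
  · have : j.succ.succAbove x = x.castSucc :=
      Fin.succAbove_of_castSucc_lt _ _ (Fin.castSucc_lt_succ_iff.2 h)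
    rw [this]
    simp
  · rw [← succAbove_castSucc_succAbove h]
    simp

theorem capTangle_comp_cupTangle_gt {n : ℕ} {i j : Fin (n + 1)} (h : j ≤ i) :
    (cupTangle i.succ).dagger.comp (cupTangle j.castSucc) =
      (cupTangle j).comp (cupTangle i).dagger := by
  refine AnnularTangle.ext (PEquiv.ext fun x => ?_)
  change Fin.insertNth (α := fun _ => Option (Fin (n + 1))) i.succ none some
      (j.castSucc.succAbove x) =
    (Fin.insertNth (α := fun _ => Option (Fin n)) i none some x).bind
      fun y => some (j.succAbove y)
  rcases Fin.eq_self_or_eq_succAbove i x with rfl | ⟨y, rfl⟩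
  · have : j.castSucc.succAbove x = x.succ :=
      Fin.succAbove_of_le_castSucc _ _ (Fin.castSucc_le_castSucc_iff.2 h)
    rw [this]
    simp
  · rw [succAbove_castSucc_succAbove h]
    simp

theorem capTangle_comp_cupTangle_self {n : ℕ} (i : Fin (n + 1)) :
    (cupTangle i).dagger.comp (cupTangle i) = AnnularTangle.one n := by
  refine AnnularTangle.ext (PEquiv.ext fun x => ?_)
  change Fin.insertNth (α := fun _ => Option (Fin n)) i none some (i.succAbove x) = some x
  simp

theorem rotation_comp_dagger (n : ℕ) :
    (rotation n).comp (rotation n).dagger = AnnularTangle.one n :=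
  AnnularTangle.ext (by
    change (finRotate n).toPEquiv.symm.trans (finRotate n).toPEquiv = PEquiv.refl _
    rw [← Equiv.toPEquiv_symm, ← Equiv.toPEquiv_trans, Equiv.symm_trans_self,
      Equiv.toPEquiv_refl])

theorem rotation_dagger_comp (n : ℕ) :
    (rotation n).dagger.comp (rotation n) = AnnularTangle.one n :=
  AnnularTangle.ext (by
    change (finRotate n).toPEquiv.trans (finRotate n).toPEquiv.symm = PEquiv.refl _
    rw [← Equiv.toPEquiv_symm, ← Equiv.toPEquiv_trans, Equiv.self_trans_symm,
      Equiv.toPEquiv_refl])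

theorem cupTangle_comp_rotation {n : ℕ} (i : Fin n) :
    (cupTangle i.succ).comp (rotation n) = (rotation (n + 1)).comp (cupTangle i.castSucc) :=
  AnnularTangle.ext (PEquiv.ext fun x => congrArg some (succAbove_castSucc_finRotate i x))

theorem capTangle_comp_rotation {n : ℕ} (i : Fin n) :
    (cupTangle i.succ).dagger.comp (rotation (n + 1)) =
      (rotation n).comp (cupTangle i.castSucc).dagger := by
  have h := congrArg AnnularTangle.dagger (cupTangle_comp_rotation i)
  have h1 := tangleCat.dagger_comp (cupTangle i.succ) (rotation n)
  have h2 := tangleCat.dagger_comp (rotation (n + 1)) (cupTangle i.castSucc)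
  have h3 := (h1.symm.trans h).trans h2
  have h4 := congrArg
    (fun T : AnnularTangle (n + 1) n => (rotation n).comp (T.comp (rotation (n + 1)))) h3
  have a1 := tangleCat.assoc (rotation n) (rotation n).dagger
    ((cupTangle i.succ).dagger.comp (rotation (n + 1)))
  have a2 := tangleCat.assoc (rotation n).dagger (cupTangle i.succ).dagger (rotation (n + 1))
  have a3 := tangleCat.assoc (cupTangle i.castSucc).dagger (rotation (n + 1)).dagger
    (rotation (n + 1))
  have o1 := tangleCat.one_comp ((cupTangle i.succ).dagger.comp (rotation (n + 1)))
  have o2 := tangleCat.comp_one (cupTangle i.castSucc).dagger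
  dsimp only [tangleCat] at *
  rw [a2, a3, ← a1, rotation_comp_dagger, rotation_dagger_comp, o1, o2] at h4
  exact h4

theorem Word.toTangle_pow_τ (n r : ℕ) :
    (Word.pow (Word.τ n) r).toTangle.strings = (finRotate n ^ r).toPEquiv := by
  induction r with
  | zero => rfl
  | succ r ih =>
    change (Word.pow (Word.τ n) r).toTangle.strings.trans (finRotate n).toPEquiv = _
    rw [ih, ← Equiv.toPEquiv_trans, pow_succ']
    rfl

theorem Word.toTangle_rel {m n : ℕ} {v w : Word m n} (h : Word.Rel v w) :
    v.toTangle = w.toTangle := by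
  induction h with
  | refl w => rfl
  | symm _ ih => exact ih.symm
  | trans _ _ ih ih' => exact ih.trans ih'
  | comp _ _ ih ih' => simp only [Word.toTangle, ih, ih']
  | dagger _ ih => rw [Word.toTangle_dagger, Word.toTangle_dagger, ih]
  | one_comp w => exact tangleCat.one_comp _
  | comp_one w => exact tangleCat.comp_one _
  | assoc u v w => exact tangleCat.assoc _ _ _
  | α_α i j h => exact cupTangle_comp_cupTangle h
  | αs_αs i j h =>
    have := congrArg AnnularTangle.dagger (cupTangle_comp_cupTangle h)
    exact ((tangleCat.dagger_comp _ _).symm.trans this.symm).trans (tangleCat.dagger_comp _ _)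
  | αs_α_lt i j h => exact capTangle_comp_cupTangle_lt h
  | αs_α_eq i => exact capTangle_comp_cupTangle_self i
  | αs_α_gt i j h => exact capTangle_comp_cupTangle_gt h
  | τ_τs n => exact rotation_comp_dagger n
  | τs_τ n => exact rotation_dagger_comp n
  | τ_pow n =>
    refine AnnularTangle.ext ?_
    rw [Word.toTangle_pow_τ, finRotate_pow_self]
    rfl
  | τ_zero => exact AnnularTangle.ext (PEquiv.ext fun x => x.elim0)
  | α_τ i => exact cupTangle_comp_rotation i
  | αs_τ i => exact capTangle_comp_rotation i

/-- The functor on words modulo the relations. -/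
def wordToTangle {m n : ℕ} : wordCat.Hom m n → AnnularTangle m n :=
  Quotient.lift Word.toTangle fun _ _ h => Word.toTangle_rel h

/-- The `*`-functor `Ψ : AG → AP` with `α_i ↦` the tangle with a cup at outer point `i`,
and `τ ↦` the one click rotation. -/
def Psi : StarFunctor AG AP where
  map {m n} := (coeffs m n).symm.toLinearMap ∘ₗ Finsupp.lmapDomain ℂ ℂ wordToTangle ∘ₗ
    (wordCat.coeffs m n).toLinearMap
  map_one n := by
    change Finsupp.mapDomain wordToTangle (Finsupp.single _ (1 : ℂ)) = Finsupp.single _ 1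
    rw [Finsupp.mapDomain_single]
    rfl
  map_comp {l m n} g f := by
    have key : ∀ (g : wordCat.Hom m n →₀ ℂ) (f : wordCat.Hom l m →₀ ℂ),
        Finsupp.mapDomain wordToTangle (wordCat.linComp g f) =
          tangleCat.linComp (Finsupp.mapDomain wordToTangle g)
            (Finsupp.mapDomain wordToTangle f) := by
      intro g f
      induction g using Finsupp.induction_linear with
      | zero => simp
      | add g g' e e' => simp [e, e', Finsupp.mapDomain_add]
      | single g b =>
        induction f using Finsupp.induction_linear with
        | zero => simp
        | add f f' e e' =>
          simp only [map_add, Finsupp.mapDomain_add, e, e']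
        | single f a =>
          rw [InvolutiveCat.linComp_single, Finsupp.mapDomain_single, Finsupp.mapDomain_single,
            Finsupp.mapDomain_single, InvolutiveCat.linComp_single]
          induction g using Quotient.inductionOn
          induction f using Quotient.inductionOn
          rfl
    exact key g f
  map_star {m n} f := by
    have key : ∀ f : wordCat.Hom m n →₀ ℂ,
        Finsupp.mapDomain wordToTangle (wordCat.linStar f) =
          tangleCat.linStar (Finsupp.mapDomain wordToTangle f) := by
      intro f
      induction f using Finsupp.induction_linear with
      | zero => simp
      | add f f' e e' => simp only [map_add, Finsupp.mapDomain_add, e, e']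
      | single f a =>
        rw [InvolutiveCat.linStar_single, Finsupp.mapDomain_single, Finsupp.mapDomain_single,
          InvolutiveCat.linStar_single]
        induction f using Quotient.inductionOn with
        | h w => exact congrArg (fun T => Finsupp.single T _) w.toTangle_dagger
    exact key f

end GICAR
end

noncomputable section

namespace GICAR

/-! ## Combinatorics of annular tangles -/

namespace AnnularTangle

variable {k l m n : ℕ}

/-! The classification is a highest weight argument, with lowest objects in the role of highest
weights. A tangle with `r` through strings factors through `[r]`, and a tangle on `[k]` with all `k`
strings through is a power of the rotation (`exists_eq_rotationPow`). Call a vector at `[k]` a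
vacuum vector if every morphism to a lower object kills it and the rotation acts on it by `ω`. Then
`AP_k` acts on it by scalars that depend only on `(k, ω)` (`exists_map_eq`).

Hence `⟨aξ, bξ⟩ = ⟨ξ, a*bξ⟩` is determined by the label and `‖ξ‖`: modules generated by unit vacuum
vectors of the same label are isomorphic. Such a module is irreducible, and its space at `[m]` has
an orthonormal basis indexed by the `k`-subsets of the `m` points. Orthogonal vacuum vectors, and
vacuum vectors with different labels, generate orthogonal submodules. In a non-zero submodule the
lowest non-zero space contains an eigenvector of the rotation, which is a vacuum vector. So
orthonormal bases of the vacuum spaces generate an orthogonal decomposition, whose multiplicities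
are the dimensions of these spaces. The modules `V^{k,ω}` enter only through the fact that each is
generated by a unit vacuum vector, namely a multiple of the projection of the class of `1` to the
`ω`-eigenspace. The choice of trace therefore does not matter.

For `Ψ` it suffices that words modulo relations correspond bijectively to tangles. Cups and caps are
peeled off one at a time: if the tangle of `f` has a cup at `p`, the relations imply `f = α_p α_p^*
f` (`proj_cls`), so `f` is recovered from a morphism with fewer points. What remains has no cups or
caps; the normal form "cups after a rotation after caps" shows that it is a power of `τ`, and such
powers are told apart by their tangles. Modules over `AG` are then exactly pullbacks of modules over
`AP`. -/

theorem comp_apply {S : AnnularTangle m n} {T : AnnularTangle l m} {i : Fin l} {c : Fin n} :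
    (S.comp T).strings i = some c ↔ ∃ b, T.strings i = some b ∧ S.strings b = some c :=
  PEquiv.trans_eq_some _ _ _ _

theorem dagger_apply {T : AnnularTangle m n} {i : Fin m} {j : Fin n} :
    T.dagger.strings j = some i ↔ T.strings i = some j :=
  PEquiv.eq_some_iff _

theorem ext_some {S T : AnnularTangle m n}
    (h : ∀ i j, S.strings i = some j ↔ T.strings i = some j) : S = T :=
  AnnularTangle.ext (PEquiv.ext fun i => Option.ext fun j => h i j)

/-- The composite of `S` with its flip is the partial identity on the range of `S`. -/
theorem comp_dagger_comp_of_range_subset {S : AnnularTangle k m} {T : AnnularTangle l m}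
    (h : T.range ⊆ S.range) : S.comp (S.dagger.comp T) = T := by
  refine ext_some fun i j => ?_
  simp only [comp_apply, dagger_apply]
  constructor
  · rintro ⟨b, ⟨c, hc, hb⟩, hj⟩
    rw [hb] at hj
    rw [hc, hj]
  · intro hj
    obtain ⟨b, hb⟩ := mem_range.1 (h (mem_range.2 ⟨i, hj⟩))
    exact ⟨b, ⟨j, hj, hb⟩, hb⟩

theorem throughStrings_le_left (T : AnnularTangle m n) : T.throughStrings ≤ m := by
  simpa [throughStrings] using
    Finset.card_le_univ (Finset.univ.filter fun i => (T.strings i).isSome)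

theorem throughStrings_le_right (T : AnnularTangle m n) : T.throughStrings ≤ n := by
  rw [← throughStrings_dagger]
  exact T.dagger.throughStrings_le_left

theorem range_eq_univ {T : AnnularTangle m n} (h : T.throughStrings = n) :
    T.range = Finset.univ :=
  Finset.eq_univ_of_card _ (by rw [← throughStrings_eq, h, Fintype.card_fin])

theorem exists_strings_eq {T : AnnularTangle m n} (h : T.throughStrings = m) (i : Fin m) :
    ∃ j, T.strings i = some j := by
  have h1 := range_eq_univ (T := T.dagger) (by rw [throughStrings_dagger, h])
  obtain ⟨j, hj⟩ := mem_range.1 (h1 ▸ Finset.mem_univ i)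
  exact ⟨j, dagger_apply.1 hj⟩

/-- The tangle without caps given by a strictly increasing map. -/
def ofEmb (f : Fin m ↪o Fin n) : AnnularTangle m n where
  strings :=
    { toFun := fun i => some (f i)
      invFun := Function.partialInv f
      inv := fun i j => by
        rw [Function.Injective.isPartialInv f.injective i j, Option.some.injEq] }
  cyclic hi hj hk := by
    have hi := Option.some.inj hi
    have hj := Option.some.inj hj
    have hk := Option.some.inj hk
    simp only [← hi, ← hj, ← hk, Fin.sbtw_iff, f.lt_iff_lt]

theorem ofEmb_apply (f : Fin m ↪o Fin n) (i : Fin m) : (ofEmb f).strings i = some (f i) := rfl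

theorem mem_range_ofEmb {f : Fin m ↪o Fin n} {j : Fin n} :
    j ∈ (ofEmb f).range ↔ ∃ i, f i = j := by
  simp only [mem_range, ofEmb_apply, Option.some.injEq]

theorem range_ofEmb_orderEmbOfFin (s : Finset (Fin n)) (h : s.card = k) :
    (ofEmb (s.orderEmbOfFin h)).range = s := by
  ext j
  rw [mem_range_ofEmb, ← Finset.mem_coe, ← Finset.range_orderEmbOfFin s h, Set.mem_range]

/-- This factors a tangle through the object numbered by its through strings, with a left factor
that depends only on the range. -/
theorem ofEmb_comp_dagger_comp (T : AnnularTangle l m) (h : T.range.card = k) :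
    (ofEmb (T.range.orderEmbOfFin h)).comp
      ((ofEmb (T.range.orderEmbOfFin h)).dagger.comp T) = T :=
  comp_dagger_comp_of_range_subset (range_ofEmb_orderEmbOfFin _ _).ge

/-- Only the points of `s ∩ t` carry a string of the composite. This yields the orthogonality of the
basis vectors in `finrank_space`. -/
theorem throughStrings_dagger_comp_lt {s t : Finset (Fin m)} (hs : s.card = k) (ht : t.card = k)
    (h : s ≠ t) : ((ofEmb (s.orderEmbOfFin hs)).dagger.comp
      (ofEmb (t.orderEmbOfFin ht))).throughStrings < k := by
  refine lt_of_le_of_ne (throughStrings_le_left _) fun he => h ?_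
  refine (Finset.eq_of_subset_of_card_le (fun j hj => ?_) (by rw [hs, ht])).symm
  rw [← range_ofEmb_orderEmbOfFin t ht, mem_range_ofEmb] at hj
  obtain ⟨i, rfl⟩ := hj
  obtain ⟨x, hx⟩ := exists_strings_eq he i
  obtain ⟨b, hb, hb'⟩ := comp_apply.1 hx
  rw [ofEmb_apply, Option.some.injEq] at hb
  subst hb
  rw [← range_ofEmb_orderEmbOfFin s hs, mem_range]
  exact ⟨x, dagger_apply.1 hb'⟩

theorem dagger_comp_ofEmb (f : Fin k ↪o Fin m) : (ofEmb f).dagger.comp (ofEmb f) = one k := by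
  refine ext_some fun i j => ?_
  simp only [comp_apply, dagger_apply, ofEmb_apply, one, PEquiv.refl_apply, Option.some.injEq]
  simp [eq_comm]

/-! ### Rotations, and tangles without cups and caps -/

/-- The `j`-fold composite of the one click rotation. -/
def rotationPow (n j : ℕ) : AnnularTangle n n := (Word.pow (Word.τ n) j).toTangle

theorem rotationPow_zero (n : ℕ) : rotationPow n 0 = one n := rfl

theorem rotationPow_succ (n j : ℕ) :
    rotationPow n (j + 1) = (rotation n).comp (rotationPow n j) := rfl

theorem rotationPow_apply (n j : ℕ) (x : Fin n) :
    (rotationPow n j).strings x = some ((finRotate n ^ j) x) := by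
  rw [rotationPow, Word.toTangle_pow_τ]
  rfl

theorem finRotate_pow_val (n j : ℕ) (x : Fin n) : ((finRotate n ^ j) x : ℕ) = (x + j) % n := by
  induction j with
  | zero => simp [Nat.mod_eq_of_lt x.is_lt]
  | succ r ih =>
    rw [pow_succ', Equiv.Perm.mul_apply, coe_finRotate', ih, ← add_assoc]
    have := Nat.mod_lt (x + r : ℕ) x.pos
    rw [← Nat.mod_add_mod (x + r : ℕ) n 1]
    split_ifs with h
    · rw [h, Nat.mod_self]
    · rw [Nat.mod_eq_of_lt (a := (x + r) % n + 1) (by omega)]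

theorem sbtw_finRotate_pow {n : ℕ} (r : ℕ) (i j k : Fin n) :
    sbtw i j k ↔ sbtw ((finRotate n ^ r) i) ((finRotate n ^ r) j) ((finRotate n ^ r) k) := by
  induction r with
  | zero => rfl
  | succ r ih =>
    simp only [pow_succ', Equiv.Perm.mul_apply]
    exact ih.trans (sbtw_finRotate _ _ _)

theorem rotationPow_comp (n i j : ℕ) :
    (rotationPow n i).comp (rotationPow n j) = rotationPow n (i + j) := by
  refine ext_some fun x y => ?_
  simp [comp_apply, rotationPow_apply, pow_add]

theorem rotationPow_self (n : ℕ) : rotationPow n n = one n := by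
  refine ext_some fun x y => ?_
  rw [rotationPow_apply, finRotate_pow_self]
  rfl

theorem rotationPow_ne_one {n j : ℕ} (h0 : 0 < j) (h : j < n) : rotationPow n j ≠ one n := by
  intro he
  have h1 : (rotationPow n j).strings ⟨0, h0.trans h⟩ = some ⟨0, h0.trans h⟩ := by rw [he]; rfl
  rw [rotationPow_apply, Option.some.injEq, Fin.ext_iff, finRotate_pow_val] at h1
  simp [Nat.mod_eq_of_lt h] at h1
  omega

/-- The tangles on `[k]` with `k` through strings are the rotations. -/
theorem exists_eq_rotationPow {T : AnnularTangle k k} (h : T.throughStrings = k) :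
    ∃ j, T = rotationPow k j := by
  cases k with
  | zero => exact ⟨0, ext_some fun i => i.elim0⟩
  | succ k =>
    choose f hf using exists_strings_eq h
    have hinj : Function.Injective f := fun i i' e => PEquiv.inj T.strings (hf i) (e ▸ hf i')
    -- Undoing the rotation by `f 0` yields a map `g` that fixes `0`. For such a map, preserving the
    -- cyclic order amounts to preserving the linear order: compare the triples `(0, a, b)`.
    set ρ := finRotate (k + 1) ^ (f 0 : ℕ) with hρ
    have hρ0 : ρ 0 = f 0 := by
      ext
      rw [hρ, finRotate_pow_val]
      simp [Nat.mod_eq_of_lt (f 0).is_lt]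
    set g : Fin (k + 1) → Fin (k + 1) := fun x => ρ.symm (f x) with hg
    have hρg : ∀ x, ρ (g x) = f x := fun x => ρ.apply_symm_apply _
    have hg0 : g 0 = 0 := by rw [hg]; simp [← hρ0]
    have hginj : Function.Injective g := ρ.symm.injective.comp hinj
    have hmono : StrictMono g := by
      intro a b hab
      rcases (Fin.zero_le a).eq_or_lt with rfl | ha
      · rw [hg0]
        refine lt_of_le_of_ne (Fin.zero_le _) fun he => hab.ne (hginj (hg0.trans he))
      · have h1 : sbtw 0 a b := Fin.sbtw_iff.2 (Or.inl ⟨ha, hab⟩)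
        rw [T.cyclic (hf 0) (hf a) (hf b), ← hρg, ← hρg, ← hρg, hρ, ← sbtw_finRotate_pow, hg0,
          Fin.sbtw_iff] at h1
        rcases h1 with h1 | h1 | h1
        · exact h1.2
        · exact absurd h1.2 (Fin.not_lt_zero _)
        · exact absurd h1.1 (Fin.not_lt_zero _)
    -- A strictly increasing self-map of a finite chain is the identity.
    have hid : g = id := le_antisymm hmono.le_id hmono.id_le
    refine ⟨f 0, ext_some fun i j => ?_⟩
    rw [rotationPow_apply, hf, ← hρ, ← hρg, hid]
    rfl

end AnnularTangle

/-! ## Normal forms in the annular GICAR category -/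

/-- The category of words, sealed against unfolding. -/
def words : InvolutiveCat := wordCat

namespace words

variable {k l m n : ℕ}

/-- Composition of classes of words. -/
local infixr:80 " ⊚ " => InvolutiveCat.comp words

/-- The class of a word. -/
def cls (w : Word m n) : words.Hom m n := Quotient.mk (Word.setoid m n) w

theorem cls_comp (v : Word m n) (w : Word l m) : cls (Word.comp v w) = cls v ⊚ cls w := rfl

theorem cls_one (n : ℕ) : cls (Word.one n) = words.one n := rfl

theorem cls_eq {v w : Word m n} (h : Word.Rel v w) : cls v = cls w := Quotient.sound h

theorem exists_cls (f : words.Hom m n) : ∃ w, cls w = f := Quotient.exists_rep f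

/-- The generator `α i`. -/
def α (i : Fin (n + 1)) : words.Hom n (n + 1) := cls (Word.α i)

/-- The adjoint of the generator `α i`. -/
def αs (i : Fin (n + 1)) : words.Hom (n + 1) n := cls (Word.αs i)

/-- The rotation. -/
def τ (n : ℕ) : words.Hom n n := cls (Word.τ n)

/-- The adjoint of the rotation. -/
def τs (n : ℕ) : words.Hom n n := cls (Word.τs n)

theorem dagger_α (i : Fin (n + 1)) : words.dagger (α i) = αs i := rfl
theorem dagger_αs (i : Fin (n + 1)) : words.dagger (αs i) = α i := rfl
theorem dagger_τ (n : ℕ) : words.dagger (τ n) = τs n := rfl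
theorem dagger_one (n : ℕ) : words.dagger (words.one n) = words.one n := rfl

theorem α_α {i j : Fin (n + 1)} (h : i ≤ j) : α i.castSucc ⊚ α j = α j.succ ⊚ α i :=
  cls_eq (Word.Rel.α_α i j h)

theorem αs_α_lt {i j : Fin (n + 1)} (h : i ≤ j) : αs i.castSucc ⊚ α j.succ = α j ⊚ αs i :=
  cls_eq (Word.Rel.αs_α_lt i j h)

theorem αs_α_eq (i : Fin (n + 1)) : αs i ⊚ α i = words.one n := cls_eq (Word.Rel.αs_α_eq i)

theorem αs_α_gt {i j : Fin (n + 1)} (h : j ≤ i) : αs i.succ ⊚ α j.castSucc = α j ⊚ αs i :=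
  cls_eq (Word.Rel.αs_α_gt i j h)

theorem τs_τ (n : ℕ) : τs n ⊚ τ n = words.one n := cls_eq (Word.Rel.τs_τ n)

theorem τ_zero : τ 0 = words.one 0 := cls_eq Word.Rel.τ_zero

theorem α_τ (i : Fin n) : α i.succ ⊚ τ n = τ (n + 1) ⊚ α i.castSucc := cls_eq (Word.Rel.α_τ i)

theorem αs_τ (i : Fin n) : αs i.succ ⊚ τ (n + 1) = τ n ⊚ αs i.castSucc :=
  cls_eq (Word.Rel.αs_τ i)

/-- Powers of the rotation. -/
def τpow (n j : ℕ) : words.Hom n n := cls (Word.pow (Word.τ n) j)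

theorem τpow_zero (n : ℕ) : τpow n 0 = words.one n := rfl

theorem τpow_succ (n j : ℕ) : τpow n (j + 1) = τ n ⊚ τpow n j := rfl

theorem τpow_self (n : ℕ) : τpow n n = words.one n := cls_eq (Word.Rel.τ_pow n)

theorem τpow_add (n i j : ℕ) : τpow n (i + j) = τpow n i ⊚ τpow n j := by
  induction i with
  | zero => rw [zero_add, τpow_zero, words.one_comp]
  | succ i ih => rw [Nat.succ_add, τpow_succ, ih, τpow_succ, words.assoc]

theorem τpow_mod (n j : ℕ) : τpow n (j % n) = τpow n j := by
  have h : ∀ q, τpow n (n * q) = words.one n := fun q => by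
    induction q with
    | zero => rfl
    | succ q ih => rw [Nat.mul_succ, τpow_add, ih, τpow_self, words.one_comp]
  conv_rhs => rw [← Nat.mod_add_div j n, τpow_add, h, words.comp_one]

theorem exists_τs_eq (n : ℕ) : ∃ c, τs n = τpow n c := by
  cases n with
  | zero => exact ⟨0, by rw [← dagger_τ, τ_zero, dagger_one, τpow_zero]⟩
  | succ n =>
    refine ⟨n, ?_⟩
    rw [← words.comp_one (τs (n + 1)), ← τpow_self, τpow_succ, ← words.assoc, τs_τ,
      words.one_comp]

/-- Each use of `α_τ` lowers the cup by one point and carries one rotation from the right to the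
left. -/
theorem α_τpow (i : ℕ) (hi : i < n + 1) :
    α (⟨i, hi⟩ : Fin (n + 1)) ⊚ τpow n i = τpow (n + 1) i ⊚ α 0 := by
  induction i with
  | zero => exact (words.comp_one _).trans (words.one_comp _).symm
  | succ i ih =>
    have h := α_τ (⟨i, by omega⟩ : Fin n)
    rw [τpow_succ, ← words.assoc]
    refine (congrArg (· ⊚ τpow n i) h).trans ?_
    change (τ (n + 1) ⊚ α ⟨i, _⟩) ⊚ τpow n i = _
    rw [words.assoc, ih (by omega), ← words.assoc, ← τpow_succ]

/-- The wrap-around case, absent from `α_τ`. It follows from `α_τpow` at the last point, because `τ`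
has order dividing `n` on `[n]` and `n + 1` on `[n + 1]`. -/
theorem τ_α_last (n : ℕ) : τ (n + 1) ⊚ α (Fin.last n) = α 0 := by
  have h := α_τpow n (Nat.lt_succ_self n)
  rw [τpow_self, words.comp_one] at h
  rw [Fin.last, h, ← words.assoc, ← τpow_succ, τpow_self, words.one_comp]

/-! ### Moving projections through words -/

/-- The projection omitting the string at the point `p`. -/
def proj : ∀ {n : ℕ}, Fin n → words.Hom n n
  | _ + 1, p => α p ⊚ αs p

theorem proj_succ (p : Fin (n + 1)) : proj p = α p ⊚ αs p := rfl

theorem dagger_proj (p : Fin n) : words.dagger (proj p) = proj p := by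
  cases n with
  | zero => exact p.elim0
  | succ n => rw [proj_succ, words.dagger_comp, dagger_α, dagger_αs]

theorem proj_α_self (i : Fin (n + 1)) : proj i ⊚ α i = α i := by
  rw [proj_succ, words.assoc, αs_α_eq, words.comp_one]

/-- The cap of the projection slides past the cup at `i`, and `α_α` then reorders the two cups. The
index shifts depend on which side of `i` the point lies. -/
theorem proj_succAbove_α (i : Fin (n + 1)) (x : Fin n) :
    proj (i.succAbove x) ⊚ α i = α i ⊚ proj x := by
  cases n with
  | zero => exact x.elim0
  | succ n =>
    rw [proj_succ, proj_succ]
    rcases lt_or_ge x.castSucc i with h | h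
    · obtain ⟨j, rfl⟩ := Fin.exists_succ_eq.2 (Fin.ne_zero_of_lt h)
      rw [Fin.succAbove_of_castSucc_lt _ _ h]
      have h := Fin.castSucc_lt_succ_iff.1 h
      rw [words.assoc, αs_α_lt h, ← words.assoc, α_α h, words.assoc]
    · obtain ⟨j, rfl⟩ := Fin.exists_castSucc_eq.2
        (ne_of_lt (h.trans_lt (Fin.castSucc_lt_last x)))
      rw [Fin.succAbove_of_le_castSucc _ _ h]
      have h := Fin.castSucc_le_castSucc_iff.1 h
      rw [words.assoc, αs_α_gt h, ← words.assoc, ← α_α h, words.assoc]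

theorem proj_αs (i : Fin (n + 1)) (x : Fin n) :
    proj x ⊚ αs i = αs i ⊚ proj (i.succAbove x) := by
  have h := congrArg words.dagger (proj_succAbove_α i x)
  rwa [words.dagger_comp, words.dagger_comp, dagger_proj, dagger_proj, dagger_α, eq_comm] at h

theorem proj_τ (x : Fin n) : proj (finRotate n x) ⊚ τ n = τ n ⊚ proj x := by
  cases n with
  | zero => exact x.elim0
  | succ n =>
    rcases Fin.eq_castSucc_or_eq_last x with ⟨y, rfl⟩ | rfl
    · have hy : finRotate (n + 1) y.castSucc = y.succ := by
        ext
        rw [coe_finRotate', Fin.val_castSucc, Fin.val_succ, if_neg (by have := y.is_lt; omega)]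
      rw [hy, proj_succ, proj_succ, words.assoc, αs_τ, ← words.assoc, α_τ, words.assoc]
    -- At the last point, substituting `α 0 = τ α_last` writes the projection at `0` as the
    -- conjugate by `τ` of the projection at the last point.
    · rw [finRotate_last, proj_succ, proj_succ, ← dagger_α, ← τ_α_last, words.dagger_comp,
        dagger_α, dagger_τ]
      simp only [words.assoc]
      rw [τs_τ, words.comp_one]

theorem proj_τs (x : Fin n) : proj x ⊚ τs n = τs n ⊚ proj (finRotate n x) := by
  have h := congrArg words.dagger (proj_τ x)
  rwa [words.dagger_comp, words.dagger_comp, dagger_proj, dagger_proj, dagger_τ, eq_comm] at h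

theorem mem_range_cupTangle {p : Fin (n + 1)} {j : Fin (n + 1)} :
    j ∈ (cupTangle p).range ↔ j ≠ p := by
  rw [AnnularTangle.mem_range]
  constructor
  · rintro ⟨i, hi⟩ rfl
    exact Fin.succAbove_ne _ _ (Option.some.inj hi)
  · intro h
    obtain ⟨i, rfl⟩ := Fin.exists_succAbove_eq h
    exact ⟨i, rfl⟩

/-- A projection can be moved through a word, and is absorbed where the tangle has a cup. -/
theorem proj_cls (w : Word m n) (p : Fin n) :
    (p ∉ w.toTangle.range → proj p ⊚ cls w = cls w) ∧
      ∀ x, w.toTangle.strings x = some p → proj p ⊚ cls w = cls w ⊚ proj x := by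
  induction w with
  | one n =>
    refine ⟨fun h => absurd (AnnularTangle.mem_range.2 ⟨p, rfl⟩) h, fun x hx => ?_⟩
    obtain rfl : x = p := Option.some.inj hx
    rw [cls_one, words.one_comp, words.comp_one]
  | comp v w hv hw =>
    simp only [cls_comp]
    rw [← words.assoc]
    refine ⟨fun h => ?_, fun x hx => ?_⟩
    -- A cup of the composite at `p` is either a cup of `v`, or comes from a string of `v` that
    -- starts at a cup of `w`.
    · by_cases hp : p ∈ v.toTangle.range
      · obtain ⟨y, hy⟩ := AnnularTangle.mem_range.1 hp
        rw [(hv p).2 y hy, words.assoc, (hw y).1]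
        intro hy'
        obtain ⟨x, hx⟩ := AnnularTangle.mem_range.1 hy'
        exact h (AnnularTangle.mem_range.2 ⟨x, AnnularTangle.comp_apply.2 ⟨y, hx, hy⟩⟩)
      · rw [(hv p).1 hp]
    · obtain ⟨y, hy, hy'⟩ := AnnularTangle.comp_apply.1 hx
      rw [(hv p).2 y hy', words.assoc, (hw y).2 x hy, words.assoc]
  | α i =>
    refine ⟨fun h => ?_, fun x hx => ?_⟩
    · obtain rfl : p = i := by
        by_contra hne
        exact h (mem_range_cupTangle.2 hne)
      exact proj_α_self p
    · obtain rfl := Option.some.inj hx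
      exact proj_succAbove_α i x
  | αs i =>
    have hs : (cupTangle i).dagger.strings (i.succAbove p) = some p :=
      AnnularTangle.dagger_apply.2 rfl
    refine ⟨fun h => absurd (AnnularTangle.mem_range.2 ⟨_, hs⟩) h, fun x hx => ?_⟩
    obtain rfl : i.succAbove p = x := Option.some.inj (AnnularTangle.dagger_apply.1 hx)
    exact proj_αs i p
  | τ n =>
    refine ⟨fun h => absurd (AnnularTangle.mem_range.2 ⟨(finRotate n).symm p, ?_⟩) h,
      fun x hx => ?_⟩
    · exact congrArg some ((finRotate n).apply_symm_apply p)
    · obtain rfl := Option.some.inj hx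
      exact proj_τ x
  | τs n =>
    have hs : (rotation n).dagger.strings (finRotate n p) = some p :=
      AnnularTangle.dagger_apply.2 rfl
    refine ⟨fun h => absurd (AnnularTangle.mem_range.2 ⟨_, hs⟩) h, fun x hx => ?_⟩
    obtain rfl : finRotate n p = x := Option.some.inj (AnnularTangle.dagger_apply.1 hx)
    exact proj_τs p

/-! ### Normal forms: cups after a rotation after caps -/

/-- Products of generators `α i`. -/
inductive IsUp {m : ℕ} : ∀ {n : ℕ}, words.Hom m n → Prop
  | one : IsUp (words.one m)
  | α_comp {n : ℕ} (i : Fin (n + 1)) {f : words.Hom m n} (hf : IsUp f) : IsUp (α i ⊚ f)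

theorem isUp_α (i : Fin (n + 1)) : IsUp (α i) := by
  rw [← words.comp_one (α i)]
  exact IsUp.α_comp i (IsUp.one)

theorem IsUp.comp {g : words.Hom m n} (hg : IsUp g) {f : words.Hom l m} (hf : IsUp f) :
    IsUp (g ⊚ f) := by
  induction hg with
  | one => rwa [words.one_comp]
  | α_comp i _ ih =>
    rw [words.assoc]
    exact IsUp.α_comp i ih

/-- Powers of the rotation. -/
def IsRot (f : words.Hom n n) : Prop := ∃ j, f = τpow n j

theorem isRot_one (n : ℕ) : IsRot (words.one n) := ⟨0, rfl⟩

theorem isRot_τ (n : ℕ) : IsRot (τ n) := ⟨1, (words.comp_one _).symm⟩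

theorem IsRot.comp {g f : words.Hom n n} (hg : IsRot g) (hf : IsRot f) : IsRot (g ⊚ f) := by
  obtain ⟨i, rfl⟩ := hg
  obtain ⟨j, rfl⟩ := hf
  exact ⟨i + j, (τpow_add n i j).symm⟩

theorem IsRot.dagger {f : words.Hom n n} (hf : IsRot f) : IsRot (words.dagger f) := by
  obtain ⟨j, rfl⟩ := hf
  induction j with
  | zero => exact isRot_one n
  | succ j ih =>
    rw [τpow_succ, words.dagger_comp, dagger_τ]
    exact ih.comp (exists_τs_eq n)

/-- A rotation moving past a cup shifts the cup by one and survives, except at the last cup, which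
becomes the cup at `0` and absorbs the rotation (`τ_α_last`). -/
theorem IsUp.τ_comp {f : words.Hom m n} (hf : IsUp f) :
    ∃ g r, IsUp g ∧ IsRot r ∧ τ n ⊚ f = g ⊚ r := by
  induction hf with
  | one =>
    exact ⟨_, _, IsUp.one, isRot_τ m, by rw [words.one_comp, words.comp_one]⟩
  | @α_comp n i f hf ih =>
    rcases Fin.eq_castSucc_or_eq_last i with ⟨y, rfl⟩ | rfl
    · obtain ⟨g, r, hg, hr, h⟩ := ih
      refine ⟨_, r, IsUp.α_comp y.succ hg, hr, ?_⟩
      rw [← words.assoc, ← α_τ, words.assoc, h, words.assoc]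
    · refine ⟨_, _, IsUp.α_comp 0 hf, isRot_one m, ?_⟩
      rw [← words.assoc, τ_α_last, words.comp_one]

theorem IsRot.comp_isUp {r : words.Hom n n} (hr : IsRot r) {f : words.Hom m n} (hf : IsUp f) :
    ∃ g s, IsUp g ∧ IsRot s ∧ r ⊚ f = g ⊚ s := by
  obtain ⟨j, rfl⟩ := hr
  induction j with
  | zero => exact ⟨f, _, hf, isRot_one m, by rw [τpow_zero, words.one_comp, words.comp_one]⟩
  | succ j ih =>
    obtain ⟨g, s, hg, hs, h⟩ := ih
    obtain ⟨g', s', hg', hs', h'⟩ := hg.τ_comp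
    refine ⟨g', _, hg', hs'.comp hs, ?_⟩
    rw [τpow_succ, words.assoc, h, ← words.assoc, h', words.assoc]

/-- The adjoint of a generator, with source not in successor form. -/
def cap : ∀ {n : ℕ}, Fin n → words.Hom n (n - 1)
  | _ + 1, p => αs p

theorem cap_succ (p : Fin (n + 1)) : cap p = αs p := rfl

/-- The cap slides past the cups until it cancels against a cup at its own point or comes out on the
other side. -/
theorem IsUp.cap_comp {f : words.Hom m n} (hf : IsUp f) (p : Fin n) :
    ∃ (k : ℕ) (g : words.Hom k (n - 1)) (h : words.Hom k m),
      IsUp g ∧ IsUp h ∧ cap p ⊚ f = g ⊚ words.dagger h := by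
  induction hf with
  | one =>
    cases m with
    | zero => exact p.elim0
    | succ m =>
      exact ⟨m, _, _, IsUp.one, isUp_α p, by
        rw [words.comp_one, words.one_comp, dagger_α, cap_succ]⟩
  | @α_comp n i f hf ih =>
    rcases eq_or_ne p i with rfl | hne
    · refine ⟨m, f, _, hf, IsUp.one, ?_⟩
      rw [cap_succ, ← words.assoc, αs_α_eq, dagger_one]
      exact (words.one_comp _).trans (words.comp_one _).symm
    · obtain ⟨x, rfl⟩ := Fin.exists_succAbove_eq hne
      cases n with
      | zero => exact x.elim0
      | succ n =>
        obtain ⟨j, hj⟩ : ∃ j : Fin (n + 1), αs (i.succAbove x) ⊚ α i = α j ⊚ αs x := by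
          rcases lt_or_ge x.castSucc i with h | h
          · obtain ⟨j, rfl⟩ := Fin.exists_succ_eq.2 (Fin.ne_zero_of_lt h)
            rw [Fin.succAbove_of_castSucc_lt _ _ h]
            exact ⟨j, αs_α_lt (Fin.castSucc_lt_succ_iff.1 h)⟩
          · obtain ⟨j, rfl⟩ := Fin.exists_castSucc_eq.2
              (ne_of_lt (h.trans_lt (Fin.castSucc_lt_last x)))
            rw [Fin.succAbove_of_le_castSucc _ _ h]
            exact ⟨j, αs_α_gt (Fin.castSucc_le_castSucc_iff.1 h)⟩
        obtain ⟨k, g, h, hg, hh, e⟩ := ih x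
        refine ⟨k, _, h, IsUp.α_comp j hg, hh, ?_⟩
        rw [cap_succ] at e
        rw [cap_succ, ← words.assoc]
        refine (congrArg (· ⊚ f) hj).trans ?_
        change (α j ⊚ αs x) ⊚ f = (α j ⊚ g) ⊚ words.dagger h
        rw [words.assoc, words.assoc, e]

/-- Morphisms which are cups after a rotation after caps. -/
def IsNormal (f : words.Hom m n) : Prop :=
  ∃ (k : ℕ) (a : words.Hom k n) (r : words.Hom k k) (b : words.Hom k m),
    IsUp a ∧ IsRot r ∧ IsUp b ∧ f = a ⊚ r ⊚ words.dagger b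

theorem isNormal_one (n : ℕ) : IsNormal (words.one n) :=
  ⟨n, _, _, _, IsUp.one, isRot_one n, IsUp.one, by
    rw [dagger_one, words.comp_one, words.comp_one]⟩

theorem IsNormal.rot_comp {r : words.Hom n n} (hr : IsRot r) {f : words.Hom m n}
    (hf : IsNormal f) : IsNormal (r ⊚ f) := by
  obtain ⟨k, a, s, b, ha, hs, hb, rfl⟩ := hf
  obtain ⟨a', s', ha', hs', e⟩ := hr.comp_isUp ha
  refine ⟨k, a', s' ⊚ s, b, ha', hs'.comp hs, hb, ?_⟩
  rw [← words.assoc, e, words.assoc, words.assoc]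

theorem IsNormal.αs_comp (i : Fin (n + 1)) {f : words.Hom m (n + 1)} (hf : IsNormal f) :
    IsNormal (αs i ⊚ f) := by
  obtain ⟨k, a, s, b, ha, hs, hb, rfl⟩ := hf
  obtain ⟨k', g, h, hg, hh, e⟩ := ha.cap_comp i
  -- The caps `h*` stand to the left of the rotation `s`. Since `h* s = (s* h)*`, the adjoint of
  -- `IsRot.comp_isUp` interchanges them.
  obtain ⟨h', s', hh', hs', e'⟩ := hs.dagger.comp_isUp hh
  refine ⟨k', g, words.dagger s', b ⊚ h', hg, hs'.dagger, hb.comp hh', ?_⟩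
  have e'' := congrArg words.dagger e'
  rw [words.dagger_comp, words.dagger_comp, words.dagger_dagger] at e''
  rw [cap_succ] at e
  rw [← words.assoc, e, words.dagger_comp, ← words.assoc (words.dagger s'), ← e'']
  simp only [words.assoc]

theorem IsNormal.cls_comp (w : Word m n) {f : words.Hom l m} (hf : IsNormal f) :
    IsNormal (cls w ⊚ f) := by
  induction w with
  | one n => rwa [cls_one, words.one_comp]
  | comp v w hv hw =>
    rw [words.cls_comp, words.assoc]
    exact hv (hw hf)
  | α i =>
    obtain ⟨k, a, s, b, ha, hs, hb, rfl⟩ := hf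
    exact ⟨k, _, s, b, IsUp.α_comp i ha, hs, hb, (words.assoc _ _ _).symm⟩
  | αs i => exact hf.αs_comp i
  | τ n => exact hf.rot_comp (isRot_τ n)
  | τs n => exact hf.rot_comp (exists_τs_eq n)

theorem isNormal (f : words.Hom m n) : IsNormal f := by
  obtain ⟨w, rfl⟩ := exists_cls f
  rw [← words.comp_one (cls w)]
  exact (isNormal_one m).cls_comp w

/-! ### Morphisms of words are determined by their tangles, and every tangle occurs -/

/-- The tangle of a class of words. -/
def tangleOf (f : words.Hom m n) : AnnularTangle m n := wordToTangle f

theorem tangleOf_comp (g : words.Hom m n) (f : words.Hom l m) :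
    tangleOf (g ⊚ f) = (tangleOf g).comp (tangleOf f) := by
  obtain ⟨v, rfl⟩ := exists_cls g
  obtain ⟨w, rfl⟩ := exists_cls f
  rfl

theorem tangleOf_dagger (f : words.Hom m n) :
    tangleOf (words.dagger f) = (tangleOf f).dagger := by
  obtain ⟨w, rfl⟩ := exists_cls f
  exact w.toTangle_dagger

theorem tangleOf_τpow (n j : ℕ) : tangleOf (τpow n j) = AnnularTangle.rotationPow n j := rfl

theorem proj_comp (f : words.Hom m n) {p : Fin n} (h : p ∉ (tangleOf f).range) :
    proj p ⊚ f = f := by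
  obtain ⟨w, rfl⟩ := exists_cls f
  exact (proj_cls w p).1 h

theorem range_comp_subset (S : AnnularTangle m n) (T : AnnularTangle l m) :
    (S.comp T).range ⊆ S.range := by
  intro j
  simp only [AnnularTangle.mem_range]
  rintro ⟨i, hi⟩
  obtain ⟨b, -, hb⟩ := AnnularTangle.comp_apply.1 hi
  exact ⟨b, hb⟩

/-- The outermost generator `α i` would keep the point `i` out of the range. -/
theorem IsUp.eq_one_of_range {f : words.Hom m n} (hf : IsUp f)
    (h : (tangleOf f).range = Finset.univ) : ∃ e : m = n, f = e ▸ words.one m := by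
  cases hf with
  | one => exact ⟨rfl, rfl⟩
  | α_comp i hf =>
    have hi := range_comp_subset _ _ ((tangleOf_comp (α i) _ ▸ h).ge (Finset.mem_univ i))
    exact absurd rfl (mem_range_cupTangle.1 hi)

/-- In the normal form of `f`, a non-trivial cup part would leave a cup in the tangle and a
non-trivial cap part a cap. Source and target have the same number of points, so there are no caps
either, and only the rotation remains. -/
theorem isRot_of_range {f : words.Hom n n} (h : (tangleOf f).range = Finset.univ) :
    IsRot f := by
  have h' : (tangleOf f).dagger.range = Finset.univ := by
    apply AnnularTangle.range_eq_univ
    rw [AnnularTangle.throughStrings_dagger, AnnularTangle.throughStrings_eq, h,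
      Finset.card_univ, Fintype.card_fin]
  obtain ⟨k, a, r, b, ha, hr, hb, rfl⟩ := isNormal f
  obtain ⟨rfl, rfl⟩ := ha.eq_one_of_range (by
    rw [tangleOf_comp] at h
    exact Finset.univ_subset_iff.1 (h.ge.trans (range_comp_subset _ _)))
  obtain ⟨e, rfl⟩ := hb.eq_one_of_range (by
    rw [← tangleOf_dagger, words.dagger_comp, words.dagger_comp, words.dagger_dagger,
      words.assoc, tangleOf_comp] at h'
    exact Finset.univ_subset_iff.1 (h'.ge.trans (range_comp_subset _ _)))
  rw [dagger_one, words.one_comp, words.comp_one]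
  exact hr

theorem eq_of_full (T : AnnularTangle m n) (h : T.range = Finset.univ)
    (h' : T.dagger.range = Finset.univ) : T.throughStrings = n ∧ m = n := by
  have h1 := T.throughStrings_eq
  have h2 := T.dagger.throughStrings_eq
  rw [T.throughStrings_dagger, h', Finset.card_univ, Fintype.card_fin] at h2
  rw [h, Finset.card_univ, Fintype.card_fin] at h1
  exact ⟨h1, h2.symm.trans h1⟩

/-- Induction on the total number of marked points. A cup at `p` gives `f = α_p (α_p^* f)` and the
same for `g`, and `α_p^*` removes a point; caps are treated through the adjoint. Without cups and
caps both morphisms are powers of `τ`, and the image of the point `0` determines the exponent modulo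
the order. -/
theorem tangleOf_injective_aux (N : ℕ) : ∀ {m n : ℕ} (f g : words.Hom m n), m + n = N →
    tangleOf f = tangleOf g → f = g := by
  induction N using Nat.strong_induction_on with
  | _ N ih =>
    intro m n f g hN hfg
    by_cases h : (tangleOf f).range = Finset.univ
    · by_cases h' : (tangleOf f).dagger.range = Finset.univ
      · obtain ⟨-, rfl⟩ := eq_of_full _ h h'
        obtain ⟨i, hi⟩ := isRot_of_range h
        obtain ⟨j, hj⟩ := isRot_of_range (hfg ▸ h)
        rw [hi, hj]
        rw [hi, hj, tangleOf_τpow, tangleOf_τpow] at hfg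
        cases m with
        | zero =>
          -- On `[0]` there is no point from which to read the exponent; the relation `τ = 1`
          -- settles this case.
          have h0 : ∀ i, τpow 0 i = words.one 0 := fun i => by
            induction i with
            | zero => rfl
            | succ i ih => rw [τpow_succ, ih, τ_zero, words.comp_one]
          rw [h0, h0]
        | succ m =>
          have h0 : (AnnularTangle.rotationPow (m + 1) i).strings 0 =
              (AnnularTangle.rotationPow (m + 1) j).strings 0 := by rw [hfg]
          rw [AnnularTangle.rotationPow_apply, AnnularTangle.rotationPow_apply,
            Option.some.injEq, Fin.ext_iff, AnnularTangle.finRotate_pow_val,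
            AnnularTangle.finRotate_pow_val] at h0
          simp only [Fin.val_zero, zero_add] at h0
          rw [← τpow_mod, h0, τpow_mod]
      · obtain ⟨p, hp⟩ : ∃ p, p ∉ (tangleOf f).dagger.range := by
          by_contra hc
          push Not at hc
          exact h' (Finset.eq_univ_of_forall hc)
        cases m with
        | zero => exact p.elim0
        | succ m =>
          -- A cap of `f` at `p` is a cup of its adjoint.
          have hf := proj_comp (words.dagger f) (p := p) (by rwa [tangleOf_dagger])
          have hg := proj_comp (words.dagger g) (p := p) (by rwa [tangleOf_dagger, ← hfg])
          have e := ih (n + m) (by omega) (αs p ⊚ words.dagger f) (αs p ⊚ words.dagger g) rfl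
            (by simp only [tangleOf_comp, tangleOf_dagger, hfg])
          rw [← words.dagger_dagger f, ← words.dagger_dagger g, ← hf, ← hg, proj_succ,
            words.assoc, words.assoc, e]
    · obtain ⟨p, hp⟩ : ∃ p, p ∉ (tangleOf f).range := by
        by_contra hc
        push Not at hc
        exact h (Finset.eq_univ_of_forall hc)
      cases n with
      | zero => exact p.elim0
      | succ n =>
        have hf := proj_comp f hp
        have hg := proj_comp g (hfg ▸ hp)
        have e := ih (m + n) (by omega) (αs p ⊚ f) (αs p ⊚ g) rfl
          (by simp only [tangleOf_comp, hfg])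
        rw [← hf, ← hg, proj_succ, words.assoc, words.assoc, e]

theorem cupTangle_comp_dagger_comp {p : Fin (n + 1)} {T : AnnularTangle m (n + 1)}
    (h : p ∉ T.range) : (cupTangle p).comp ((cupTangle p).dagger.comp T) = T :=
  AnnularTangle.comp_dagger_comp_of_range_subset fun _ hj =>
    mem_range_cupTangle.2 fun e => h (e ▸ hj)

/-- The same peeling of cups and caps, now on tangles, ends at a tangle with all strings through,
which is a rotation by `exists_eq_rotationPow`. -/
theorem tangleOf_surjective_aux (N : ℕ) : ∀ {m n : ℕ} (T : AnnularTangle m n), m + n = N →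
    ∃ f, tangleOf f = T := by
  induction N using Nat.strong_induction_on with
  | _ N ih =>
    intro m n T hN
    by_cases h : T.range = Finset.univ
    · by_cases h' : T.dagger.range = Finset.univ
      · obtain ⟨hT, rfl⟩ := eq_of_full _ h h'
        obtain ⟨j, rfl⟩ := AnnularTangle.exists_eq_rotationPow hT
        exact ⟨τpow m j, rfl⟩
      · obtain ⟨p, hp⟩ : ∃ p, p ∉ T.dagger.range := by
          by_contra hc
          push Not at hc
          exact h' (Finset.eq_univ_of_forall hc)
        cases m with
        | zero => exact p.elim0
        | succ m =>
          obtain ⟨f, hf⟩ := ih (n + m) (by omega) ((cupTangle p).dagger.comp T.dagger) rfl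
          refine ⟨words.dagger (α p ⊚ f), ?_⟩
          rw [tangleOf_dagger, tangleOf_comp, hf]
          exact (congrArg AnnularTangle.dagger (cupTangle_comp_dagger_comp hp)).trans
            (tangleCat.dagger_dagger T)
    · obtain ⟨p, hp⟩ : ∃ p, p ∉ T.range := by
        by_contra hc
        push Not at hc
        exact h (Finset.eq_univ_of_forall hc)
      cases n with
      | zero => exact p.elim0
      | succ n =>
        obtain ⟨f, hf⟩ := ih (m + n) (by omega) ((cupTangle p).dagger.comp T) rfl
        refine ⟨α p ⊚ f, ?_⟩
        rw [tangleOf_comp, hf]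
        exact cupTangle_comp_dagger_comp hp

end words

/-- Two words represent the same tangle exactly when they are congruent, and every tangle is
represented by a word. -/
theorem wordToTangle_bijective {m n : ℕ} :
    Function.Bijective (wordToTangle : wordCat.Hom m n → AnnularTangle m n) :=
  ⟨fun f g h => words.tangleOf_injective_aux _ (f : words.Hom m n) g rfl h,
    fun T => words.tangleOf_surjective_aux _ T rfl⟩

theorem Psi_isIso : Psi.IsIso := fun m n => by
  have h : Function.Bijective (Finsupp.lmapDomain ℂ ℂ
      (wordToTangle : wordCat.Hom m n → AnnularTangle m n)) := by
    refine ⟨Finsupp.mapDomain_injective wordToTangle_bijective.1, ?_⟩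
    exact Finsupp.mapDomain_surjective wordToTangle_bijective.2
  exact (coeffs m n).symm.bijective.comp (h.comp (wordCat.coeffs m n).bijective)

/-! ## Vacuum vectors -/

namespace HilbertModule

variable {k l m n : ℕ}

/-- The vectors of `W` at the weight of `s` which are killed by all morphisms to lower objects
and on which the rotation acts by `s.ω`. -/
def vacuum (W : HilbertModule.{u} AP) (s : Label) : Submodule ℂ (W.space s.k) where
  carrier := {ξ | (∀ j < s.k, ∀ c : AP.Hom s.k j, W.map c ξ = 0) ∧
    W.map (tangle (rotation s.k)) ξ = s.ω • ξ}
  zero_mem' := ⟨fun _ _ _ => map_zero _, by rw [map_zero, smul_zero]⟩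
  add_mem' h h' := ⟨fun j hj c => by rw [map_add, h.1 j hj, h'.1 j hj, add_zero], by
    rw [map_add, h.2, h'.2, smul_add]⟩
  smul_mem' z ξ h := ⟨fun j hj c => by rw [map_smul, h.1 j hj, smul_zero], by
    rw [map_smul, h.2, smul_comm]⟩

theorem map_comp_apply {C : LinearInvolutiveCat} (W : HilbertModule.{u} C) (g : C.Hom m n)
    (f : C.Hom l m) (ξ : W.space l) : W.map (C.comp g f) ξ = W.map g (W.map f ξ) := by
  rw [W.map_comp]
  rfl

theorem map_one_apply {C : LinearInvolutiveCat} (W : HilbertModule.{u} C) (ξ : W.space l) :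
    W.map (C.one l) ξ = ξ := by
  rw [W.map_one]
  rfl

theorem inner_map_map {C : LinearInvolutiveCat} (W : HilbertModule.{u} C) (a : C.Hom k m)
    (b : C.Hom l m) (ξ : W.space k) (η : W.space l) :
    Inner.inner ℂ (W.map a ξ) (W.map b η) = Inner.inner ℂ ξ (W.map (C.comp (C.star a) b) η) := by
  rw [W.inner_map, map_comp_apply]

theorem map_rotationPow {W : HilbertModule.{u} AP} {ω : ℂ} {ξ : W.space k}
    (h : W.map (tangle (rotation k)) ξ = ω • ξ) (j : ℕ) :
    W.map (tangle (AnnularTangle.rotationPow k j)) ξ = ω ^ j • ξ := by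
  induction j with
  | zero =>
    rw [pow_zero, one_smul]
    exact W.map_one_apply ξ
  | succ j ih =>
    rw [AnnularTangle.rotationPow_succ, ← comp_tangle, map_comp_apply, ih, map_smul, h,
      smul_smul, pow_succ]

section Vacuum

variable {W : HilbertModule.{u} AP} {s : Label} {ξ : W.space s.k}

/-- The target `[m]` need not be lower than `[s.k]`, but `T` factors through the object numbered by
its through strings, which is. -/
theorem map_tangle_of_lt (hξ : ξ ∈ W.vacuum s) {T : AnnularTangle s.k m}
    (hT : T.throughStrings < s.k) : W.map (tangle T) ξ = 0 := by
  rw [← AnnularTangle.ofEmb_comp_dagger_comp T T.throughStrings_eq.symm, ← comp_tangle,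
    map_comp_apply, hξ.1 _ hT, map_zero]

/-- Endomorphisms act on vacuum vectors by a scalar which only depends on the label. -/
theorem exists_map_eq {V : HilbertModule.{v} AP} {ζ : V.space s.k} (hξ : ξ ∈ W.vacuum s)
    (hζ : ζ ∈ V.vacuum s) (a : AP.Hom s.k s.k) :
    ∃ z : ℂ, W.map a ξ = z • ξ ∧ V.map a ζ = z • ζ := by
  induction a using hom_induction with
  | zero => exact ⟨0, by simp, by simp⟩
  | add a b ha hb =>
    obtain ⟨x, hx, hx'⟩ := ha
    obtain ⟨y, hy, hy'⟩ := hb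
    exact ⟨x + y, by simp [hx, hy, add_smul], by simp [hx', hy', add_smul]⟩
  | smul z T =>
    rcases T.throughStrings_le_left.lt_or_eq with h | h
    · exact ⟨0, by simp [map_tangle_of_lt hξ h], by simp [map_tangle_of_lt hζ h]⟩
    -- The remaining tangles are powers of the rotation, which act by powers of `s.ω` in both
    -- modules.
    · obtain ⟨j, rfl⟩ := AnnularTangle.exists_eq_rotationPow h
      exact ⟨z * s.ω ^ j, by simp [map_rotationPow hξ.2, mul_smul],
        by simp [map_rotationPow hζ.2, mul_smul]⟩

/-- Both sides are `z` times the squared norm, with `z` the common scalar by which `a* b` acts. Thus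
the label and the norm fix the geometry of a module generated by a vacuum vector. -/
theorem inner_map_map_eq {V : HilbertModule.{v} AP} {ζ : V.space s.k} (hξ : ξ ∈ W.vacuum s)
    (hζ : ζ ∈ V.vacuum s) (h : ‖ξ‖ = ‖ζ‖) (a b : AP.Hom s.k m) :
    Inner.inner ℂ (W.map a ξ) (W.map b ξ) = Inner.inner ℂ (V.map a ζ) (V.map b ζ) := by
  rw [inner_map_map, inner_map_map]
  obtain ⟨z, hz, hz'⟩ := exists_map_eq hξ hζ (AP.comp (AP.star a) b)
  rw [hz, hz', inner_smul_right, inner_smul_right, inner_self_eq_norm_sq_to_K,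
    inner_self_eq_norm_sq_to_K, h]

theorem inner_map_map_eq_zero {η : W.space s.k} (hξ : ξ ∈ W.vacuum s) (hη : η ∈ W.vacuum s)
    (h : Inner.inner ℂ ξ η = 0) (a b : AP.Hom s.k m) :
    Inner.inner ℂ (W.map a ξ) (W.map b η) = 0 := by
  rw [inner_map_map]
  obtain ⟨z, -, hz⟩ := exists_map_eq hξ hη (AP.comp (AP.star a) b)
  rw [hz, inner_smul_right, h, mul_zero]

/-- The rotation is unitary, so `⟨ξ, η⟩ = ω̄ ω' ⟨ξ, η⟩`. -/
theorem inner_eq_zero_of_ne {ω ω' : ℂ} {ξ η : W.space k} (hω : ‖ω‖ = 1) (hne : ω ≠ ω')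
    (hξ : W.map (tangle (rotation k)) ξ = ω • ξ)
    (hη : W.map (tangle (rotation k)) η = ω' • η) : Inner.inner ℂ ξ η = 0 := by
  have h := W.inner_map_map (tangle (rotation k)) (tangle (rotation k)) ξ η
  rw [star_tangle, comp_tangle, rotation_dagger_comp] at h
  have h1 : W.map (tangle (AnnularTangle.one k)) η = η := W.map_one_apply η
  rw [h1, hξ, hη, inner_smul_left, inner_smul_right, ← mul_assoc] at h
  by_contra h0
  have h2 : (starRingEnd ℂ ω) * ω' = 1 := mul_right_cancel₀ h0 (by rw [h, one_mul])
  refine hne ?_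
  have h3 : ω * starRingEnd ℂ ω = 1 := by rw [Complex.mul_conj', hω]; simp
  calc ω = ω * ((starRingEnd ℂ ω) * ω') := by rw [h2, mul_one]
    _ = ω' := by rw [← mul_assoc, h3, one_mul]

/-- For different weights, `a* b` or its adjoint lowers the object and kills the vacuum vector it is
applied to. For equal weights `a* b` acts on `η` by a scalar, and the eigenvalues of the rotation
differ. -/
theorem inner_map_map_eq_zero_of_ne {s' : Label} (hs : s ≠ s') {η : W.space s'.k}
    (hξ : ξ ∈ W.vacuum s) (hη : η ∈ W.vacuum s') (a : AP.Hom s.k m) (b : AP.Hom s'.k m) :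
    Inner.inner ℂ (W.map a ξ) (W.map b η) = 0 := by
  rcases lt_trichotomy s.k s'.k with h | h | h
  · rw [inner_map_map, hη.1 _ h, inner_zero_right]
  · obtain ⟨k, ω, h1, h2⟩ := s
    obtain ⟨k', ω', h1', h2'⟩ := s'
    dsimp only at h
    subst h
    have hne : ω ≠ ω' := fun e => hs (by subst e; rfl)
    -- At weight `0` both eigenvalues are `1`. Only for `k ≠ 0` does `ω ^ k = 1` give `‖ω‖ = 1`.
    have hk : k ≠ 0 := fun e => hne ((h2 e).trans (h2' e).symm)
    have h0 := inner_eq_zero_of_ne (Complex.norm_eq_one_of_pow_eq_one h1 hk) hne hξ.2 hη.2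
    rw [inner_map_map]
    obtain ⟨z, -, hz⟩ := exists_map_eq hη hη (AP.comp (AP.star a) b)
    rw [hz]
    exact (inner_smul_right _ _ _).trans (by rw [h0, mul_zero])
  · rw [← inner_conj_symm, inner_map_map, hξ.1 _ h, inner_zero_right, map_zero]

end Vacuum

/-! ## Modules generated by a vacuum vector -/

/-- The vector `ξ` generates the module. -/
def Generates {C : LinearInvolutiveCat} (W : HilbertModule.{u} C) (ξ : W.space k) : Prop :=
  ∀ m (x : W.space m), ∃ a : C.Hom k m, W.map a ξ = x

/-- The submodule generated by a vector. -/
def generated {C : LinearInvolutiveCat} (W : HilbertModule.{u} C) (ξ : W.space k) : W.Sub where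
  space n := LinearMap.range (W.map.flip ξ : C.Hom k n →ₗ[ℂ] W.space n)
  map_mem c := by
    rintro _ ⟨a, rfl⟩
    exact ⟨C.comp c a, W.map_comp_apply c a ξ⟩

theorem mem_generated {C : LinearInvolutiveCat} {W : HilbertModule.{u} C} {ξ : W.space k}
    {x : W.space m} : x ∈ (W.generated ξ).space m ↔ ∃ a : C.Hom k m, W.map a ξ = x := Iff.rfl

theorem self_mem_generated {C : LinearInvolutiveCat} (W : HilbertModule.{u} C) (ξ : W.space k) :
    ξ ∈ (W.generated ξ).space k := mem_generated.2 ⟨_, W.map_one_apply ξ⟩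

theorem generates_generated {C : LinearInvolutiveCat} (W : HilbertModule.{u} C) (ξ : W.space k) :
    (W.generated ξ).toHilbertModule.Generates
      (⟨ξ, W.self_mem_generated ξ⟩ : (W.generated ξ).space k) := by
  rintro m ⟨_, a, rfl⟩
  exact ⟨a, rfl⟩

theorem mem_vacuum_toHilbertModule {W : HilbertModule.{u} AP} {s : Label} (X : W.Sub)
    (ξ : X.space s.k) : ξ ∈ X.toHilbertModule.vacuum s ↔ (ξ : W.space s.k) ∈ W.vacuum s := by
  constructor
  · exact fun h => ⟨fun j hj c => congrArg Subtype.val (h.1 j hj c), congrArg Subtype.val h.2⟩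
  · exact fun h => ⟨fun j hj c => Subtype.ext (h.1 j hj c), Subtype.ext h.2⟩

/-- As in the GNS construction: the form on `A` determines the kernel, so `E` and `F` are the same
quotient of `A` with the same inner product. -/
theorem exists_isometryEquiv {A E F : Type*} [AddCommGroup A] [Module ℂ A]
    [NormedAddCommGroup E] [InnerProductSpace ℂ E] [NormedAddCommGroup F]
    [InnerProductSpace ℂ F] (f : A →ₗ[ℂ] E) (g : A →ₗ[ℂ] F) (hf : Function.Surjective f)
    (hg : Function.Surjective g) (h : ∀ a b, Inner.inner ℂ (f a) (f b) = Inner.inner ℂ (g a) (g b)) :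
    ∃ e : E ≃ₗᵢ[ℂ] F, ∀ a, e (f a) = g a := by
  have hk : LinearMap.ker f = LinearMap.ker g := by
    ext a
    rw [LinearMap.mem_ker, LinearMap.mem_ker, ← inner_self_eq_zero (𝕜 := ℂ), h,
      inner_self_eq_zero]
  let e : E ≃ₗ[ℂ] F := (f.quotKerEquivOfSurjective hf).symm ≪≫ₗ
    Submodule.quotEquivOfEq _ _ hk ≪≫ₗ g.quotKerEquivOfSurjective hg
  have he : ∀ a, e (f a) = g a := fun a => by
    have : (f.quotKerEquivOfSurjective hf).symm (f a) = Submodule.Quotient.mk a := by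
      rw [LinearEquiv.symm_apply_eq]
      rfl
    simp only [e, LinearEquiv.trans_apply, this]
    rfl
  refine ⟨e.isometryOfInner fun x y => ?_, he⟩
  obtain ⟨a, rfl⟩ := hf x
  obtain ⟨b, rfl⟩ := hf y
  rw [he, he, h]

/-- Modules generated by vacuum vectors with the same label are isomorphic. -/
theorem nonempty_iso_of_generates {W : HilbertModule.{u} AP} {V : HilbertModule.{v} AP}
    {s : Label} {ξ : W.space s.k} {ζ : V.space s.k} (hξ : ξ ∈ W.vacuum s) (hζ : ζ ∈ V.vacuum s)
    (h : ‖ξ‖ = ‖ζ‖) (hW : W.Generates ξ) (hV : V.Generates ζ) : Nonempty (W.Iso V) := by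
  have key : ∀ m, ∃ e : W.space m ≃ₗᵢ[ℂ] V.space m,
      ∀ a : AP.Hom s.k m, e (W.map a ξ) = V.map a ζ := fun m =>
    exists_isometryEquiv (W.map.flip ξ) (V.map.flip ζ) (hW m) (hV m)
      (inner_map_map_eq hξ hζ h)
  choose e he using key
  refine ⟨⟨e, fun {m n} c x => ?_⟩⟩
  obtain ⟨a, rfl⟩ := hW m x
  rw [← map_comp_apply, he, he, map_comp_apply]

theorem Iso.map_vacuum {W : HilbertModule.{u} AP} {V : HilbertModule.{v} AP} (e : W.Iso V)
    {s : Label} {ξ : W.space s.k} (hξ : ξ ∈ W.vacuum s) : e.equiv s.k ξ ∈ V.vacuum s :=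
  ⟨fun j hj c => by rw [← e.natural, hξ.1 j hj, map_zero], by
    rw [← e.natural, hξ.2, map_smul]⟩

/-- The inverse isomorphism. -/
def Iso.symm {C : LinearInvolutiveCat} {W : HilbertModule.{u} C} {V : HilbertModule.{v} C}
    (e : W.Iso V) : V.Iso W where
  equiv n := (e.equiv n).symm
  natural c ξ := by
    rw [LinearIsometryEquiv.symm_apply_eq, e.natural, LinearIsometryEquiv.apply_symm_apply]

theorem Iso.generates {C : LinearInvolutiveCat} {W : HilbertModule.{u} C}
    {V : HilbertModule.{v} C} (e : W.Iso V) {ξ : W.space k} (h : W.Generates ξ) :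
    V.Generates (e.equiv k ξ) := by
  intro m x
  obtain ⟨a, ha⟩ := h m ((e.equiv m).symm x)
  exact ⟨a, by rw [← e.natural, ha, LinearIsometryEquiv.apply_symm_apply]⟩

section Generated

variable {W : HilbertModule.{u} AP} {s : Label} {ξ : W.space s.k}

theorem eq_zero_of_lt (hξ : ξ ∈ W.vacuum s) (hW : W.Generates ξ) (hm : m < s.k)
    (x : W.space m) : x = 0 := by
  obtain ⟨a, rfl⟩ := hW m x
  exact hξ.1 m hm a

theorem exists_eq_smul (hξ : ξ ∈ W.vacuum s) (hW : W.Generates ξ) (x : W.space s.k) :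
    ∃ z : ℂ, x = z • ξ := by
  obtain ⟨a, rfl⟩ := hW _ x
  obtain ⟨z, hz, -⟩ := exists_map_eq hξ hξ a
  exact ⟨z, hz⟩

theorem hasWeight (hξ : ξ ∈ W.vacuum s) (hW : W.Generates ξ) (h0 : ξ ≠ 0) :
    W.HasWeight s.k := by
  refine ⟨⟨ξ, 0, h0⟩, fun m hm => ?_⟩
  by_contra hlt
  obtain ⟨x, hx⟩ := @exists_ne _ hm (0 : W.space m)
  exact hx (eq_zero_of_lt hξ hW (not_le.1 hlt) x)

/-- The space at the weight is the line through `ξ`, so a submodule either contains `ξ`, hence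
everything, or vanishes there. In the second case it is orthogonal to every `a ξ`, because `⟨x, a ξ⟩
= ⟨a* x, ξ⟩`. -/
theorem isIrreducible (hξ : ξ ∈ W.vacuum s) (hW : W.Generates ξ) (h0 : ξ ≠ 0) :
    W.IsIrreducible := by
  refine ⟨⟨s.k, ⟨ξ, 0, h0⟩⟩, fun X => ?_⟩
  by_cases hX : ξ ∈ X.space s.k
  · refine Or.inr fun n => Submodule.eq_top_iff'.2 fun x => ?_
    obtain ⟨a, rfl⟩ := hW n x
    exact X.map_mem a hX
  · have hk : ∀ x ∈ X.space s.k, x = 0 := by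
      intro x hx
      obtain ⟨z, rfl⟩ := exists_eq_smul hξ hW x
      rcases eq_or_ne z 0 with rfl | hz
      · exact zero_smul _ _
      · exact absurd (((X.space s.k).smul_mem_iff hz).1 hx) hX
    refine Or.inl fun n => (Submodule.eq_bot_iff _).2 fun x hx => ?_
    obtain ⟨a, ha⟩ := hW n x
    rw [← inner_self_eq_zero (𝕜 := ℂ)]
    nth_rw 2 [← ha]
    rw [← AP.star_star a, ← W.inner_map, hk _ (X.map_mem _ hx), inner_zero_left]

/-- The increasing embeddings onto the `k`-subsets of the `m` points, applied to `ξ`, form an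
orthonormal basis. A tangle with `k` through strings is such an embedding after an endomorphism of
`[k]`, which acts on `ξ` by a scalar. -/
theorem finrank_space (hξ : ξ ∈ W.vacuum s) (hW : W.Generates ξ) (h1 : ‖ξ‖ = 1) (m : ℕ) :
    Module.finrank ℂ (W.space m) = m.choose s.k := by
  classical
  let b : {S : Finset (Fin m) // S.card = s.k} → W.space m := fun S =>
    W.map (tangle (AnnularTangle.ofEmb (S.1.orderEmbOfFin S.2))) ξ
  have hb : Orthonormal ℂ b := by
    rw [orthonormal_iff_ite]
    intro S T
    simp only [b]
    rw [inner_map_map, star_tangle, comp_tangle]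
    split_ifs with h
    · subst h
      rw [AnnularTangle.dagger_comp_ofEmb]
      have := W.map_one_apply ξ
      change Inner.inner ℂ ξ (W.map (AP.one s.k) ξ) = 1
      rw [this, inner_self_eq_norm_sq_to_K, h1]
      simp
    · rw [map_tangle_of_lt hξ (AnnularTangle.throughStrings_dagger_comp_lt S.2 T.2
        fun e => h (Subtype.ext e)), inner_zero_right]
  have hspan : ⊤ ≤ Submodule.span ℂ (Set.range b) := by
    intro x _
    obtain ⟨a, rfl⟩ := hW m x
    induction a using hom_induction with
    | zero => simp
    | add a c ha hc =>
      rw [map_add]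
      exact add_mem (ha trivial) (hc trivial)
    | smul z T =>
      rw [map_smul]
      refine Submodule.smul_mem _ _ ?_
      rcases T.throughStrings_le_left.lt_or_eq with h | h
      · rw [map_tangle_of_lt hξ h]
        exact zero_mem _
      · have hc : T.range.card = s.k := T.throughStrings_eq.symm.trans h
        have e := AnnularTangle.ofEmb_comp_dagger_comp T hc
        rw [← e, ← comp_tangle, map_comp_apply]
        obtain ⟨z, hz, -⟩ := exists_map_eq hξ hξ (tangle
          ((AnnularTangle.ofEmb (T.range.orderEmbOfFin hc)).dagger.comp T))
        rw [hz, map_smul]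
        exact Submodule.smul_mem _ _ (Submodule.subset_span ⟨⟨T.range, hc⟩, rfl⟩)
  rw [Module.finrank_eq_card_basis (Module.Basis.mk hb.linearIndependent hspan),
    Fintype.card_finset_len, Fintype.card_fin]

end Generated

/-- A submodule contains a vacuum vector at its lowest object. -/
theorem exists_vacuum {W : HilbertModule.{u} AP} (Y : W.Sub) (hm : Y.space m ≠ ⊥)
    (hlt : ∀ j < m, Y.space j = ⊥) :
    ∃ s : Label, s.k = m ∧ ∃ ξ ∈ W.vacuum s, ‖ξ‖ = 1 ∧ ξ ∈ Y.space s.k := by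
  have : Nontrivial (Y.space m) := Submodule.nontrivial_iff_ne_bot.2 hm
  obtain ⟨ω, hω⟩ := Module.End.exists_eigenvalue
    ((W.map (tangle (rotation m))).restrict (p := Y.space m) (q := Y.space m)
      fun _ h => Y.map_mem _ h)
  obtain ⟨⟨x, hx⟩, hv⟩ := hω.exists_hasEigenvector
  have h0 : x ≠ 0 := fun e => hv.2 (Subtype.ext e)
  have hτ : W.map (tangle (rotation m)) x = ω • x := congrArg Subtype.val hv.apply_eq_smul
  have hpow : ω ^ m = 1 := by
    have h := map_rotationPow hτ m
    rw [AnnularTangle.rotationPow_self] at h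
    have h1 : W.map (tangle (AnnularTangle.one m)) x = x := W.map_one_apply x
    refine smul_left_injective ℂ h0 ?_
    simp only [← h, h1, one_smul]
  -- For `m = 0` the equation `ω ^ m = 1` is void, and `ω = 1` comes from the triviality of the
  -- rotation on `[0]`.
  have hzero : m = 0 → ω = 1 := by
    rintro rfl
    have h1 : W.map (tangle (rotation 0)) x = x := by
      rw [show rotation 0 = AnnularTangle.one 0 from AnnularTangle.ext_some fun i => i.elim0]
      exact W.map_one_apply x
    refine smul_left_injective ℂ h0 ?_
    simp only [← hτ, h1, one_smul]
  refine ⟨⟨m, ω, hpow, hzero⟩, rfl, ((‖x‖⁻¹ : ℝ) : ℂ) • x, ?_, ?_, Submodule.smul_mem _ _ hx⟩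
  -- Morphisms to lower objects stay inside `Y`, which vanishes there.
  · refine Submodule.smul_mem _ _ ⟨fun j hj c => ?_, hτ⟩
    have := Y.map_mem c hx
    rwa [hlt j hj, Submodule.mem_bot] at this
  · have : ‖x‖ ≠ 0 := norm_ne_zero_iff.2 h0
    rw [norm_smul]
    simp [this]

end HilbertModule

/-- The inverse of an isomorphism. -/
def StarFunctor.inverse {C D : LinearInvolutiveCat} (F : StarFunctor C D)
    (hF : F.IsIso) : StarFunctor D C where
  map {m n} := (LinearEquiv.ofBijective F.map (hF m n)).symm.toLinearMap
  map_one n := (LinearEquiv.symm_apply_eq _).2 (F.map_one n).symm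
  map_comp g f := (LinearEquiv.symm_apply_eq _).2 (by
    rw [LinearEquiv.ofBijective_apply, F.map_comp]
    congr 1
    · congr 1
      exact ((LinearEquiv.ofBijective F.map (hF _ _)).apply_symm_apply g).symm
    · exact ((LinearEquiv.ofBijective F.map (hF _ _)).apply_symm_apply f).symm)
  map_star f := (LinearEquiv.symm_apply_eq _).2 (by
    rw [LinearEquiv.ofBijective_apply, F.map_star]
    congr 1
    exact ((LinearEquiv.ofBijective F.map (hF _ _)).apply_symm_apply f).symm)

/-! ## Orthogonal decompositions -/

namespace HilbertModule

variable {k l m n : ℕ}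

section Decomposition

variable {V : Label → HilbertModule.{v} AP}

/-- Each member of the family is generated by a unit vacuum vector for its label. -/
def VacuumGenerated (V : Label → HilbertModule.{v} AP) : Prop :=
  ∀ s, ∃ ζ ∈ (V s).vacuum s, ‖ζ‖ = 1 ∧ (V s).Generates ζ

/-- The multiplicity is the dimension of the space of vacuum vectors. -/
theorem mult_eq_finrank_vacuum (hV : VacuumGenerated V) {W : HilbertModule.{u} AP} {mult : Label → ℕ}
    (h : IsOrthogonalSum V W mult) (s : Label) :
    mult s = Module.finrank ℂ (W.vacuum s) := by
  obtain ⟨X, hX, horth, hsup⟩ := h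
  have key : ∀ p : Σ s, Fin (mult s), ∃ η ∈ W.vacuum p.1, ‖η‖ = 1 ∧ η ∈ (X p).space p.1.k ∧
      ∀ m, ∀ x ∈ (X p).space m, ∃ a : AP.Hom p.1.k m, W.map a η = x := by
    intro p
    obtain ⟨e⟩ := hX p
    obtain ⟨ζ, hζ, h1, hgen⟩ := hV p.1
    let η : (X p).space p.1.k := e.symm.equiv p.1.k ζ
    have hη := (mem_vacuum_toHilbertModule (X p) η).1 (e.symm.map_vacuum hζ)
    have hg := e.symm.generates hgen
    refine ⟨η, hη, ((e.symm.equiv p.1.k).norm_map ζ).trans h1, η.2, fun m x hx => ?_⟩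
    obtain ⟨a, ha⟩ := hg m ⟨x, hx⟩
    exact ⟨a, congrArg Subtype.val ha⟩
  choose η hη h1 hmem hgen using key
  -- The unit vacuum vectors of the summands with label `s` turn out to be an orthonormal basis of
  -- the vacuum space.
  let b : Fin (mult s) → W.vacuum s := fun i => ⟨η ⟨s, i⟩, hη ⟨s, i⟩⟩
  have hb : Orthonormal ℂ b := by
    refine ⟨fun i => h1 ⟨s, i⟩, fun i j hij => ?_⟩
    exact Submodule.isOrtho_iff_inner_eq.1
      (horth ⟨s, i⟩ ⟨s, j⟩ (fun e => hij (by simpa using e)) s.k) _ (hmem _) _ (hmem _)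
  have hbot : (Submodule.span ℂ (Set.range b))ᗮ = ⊥ := by
    refine (Submodule.eq_bot_iff _).2 fun ξ hξ => ?_
    have hbξ : ∀ i, Inner.inner ℂ (ξ : W.space s.k) (η ⟨s, i⟩) = 0 := fun i =>
      (Submodule.mem_orthogonal' _ _).1 hξ _ (Submodule.subset_span ⟨i, rfl⟩)
    -- A vacuum vector orthogonal to all `b i` is orthogonal to every summand, also to those with
    -- other labels, hence to itself.
    have htop : ⊤ ≤ (Submodule.span ℂ {(ξ : W.space s.k)})ᗮ := by
      rw [← hsup s.k]
      refine iSup_le fun p x hx => ?_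
      rw [Submodule.mem_orthogonal_singleton_iff_inner_right]
      obtain ⟨a, rfl⟩ := hgen p _ x hx
      rw [← W.map_one_apply (ξ : W.space s.k)]
      obtain ⟨s', i⟩ := p
      by_cases hs : s = s'
      · subst hs
        exact inner_map_map_eq_zero ξ.2 (hη ⟨s, i⟩) (hbξ i) _ _
      · exact inner_map_map_eq_zero_of_ne hs ξ.2 (hη ⟨s', i⟩) _ _
    have h0 := (Submodule.mem_orthogonal_singleton_iff_inner_right).1
      (htop (Submodule.mem_top (x := (ξ : W.space s.k))))
    exact Subtype.ext (inner_self_eq_zero.1 h0)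
  have hfin := Module.finrank_eq_card_basis
    (OrthonormalBasis.mkOfOrthogonalEqBot hb hbot).toBasis
  rw [hfin, Fintype.card_fin]

theorem isOrthogonalSum_finrank_vacuum (hV : VacuumGenerated V) (W : HilbertModule.{u} AP) :
    IsOrthogonalSum V W fun s => Module.finrank ℂ (W.vacuum s) := by
  let b : ∀ p : Σ s : Label, Fin (Module.finrank ℂ (W.vacuum s)), W.vacuum p.1 := fun p =>
    stdOrthonormalBasis ℂ (W.vacuum p.1) p.2
  have horth : ∀ p q, p ≠ q → ∀ n, (W.generated (b p : W.space p.1.k)).space n ⟂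
      (W.generated (b q : W.space q.1.k)).space n := by
    intro p q hpq n
    rw [Submodule.isOrtho_iff_inner_eq]
    rintro _ ⟨a, rfl⟩ _ ⟨c, rfl⟩
    obtain ⟨s, i⟩ := p
    obtain ⟨s', j⟩ := q
    by_cases hs : s = s'
    · subst hs
      have hij : i ≠ j := fun e => hpq (by rw [e])
      exact inner_map_map_eq_zero (b ⟨s, i⟩).2 (b ⟨s, j⟩).2
        ((stdOrthonormalBasis ℂ (W.vacuum s)).orthonormal.2 hij) a c
    · exact inner_map_map_eq_zero_of_ne hs (b ⟨s, i⟩).2 (b ⟨s', j⟩).2 a c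
  refine ⟨fun p => W.generated (b p : W.space p.1.k), fun p => ?_, horth, ?_⟩
  · obtain ⟨ζ, hζ, h1, hgen⟩ := hV p.1
    refine nonempty_iso_of_generates
      ((mem_vacuum_toHilbertModule _ ⟨_, W.self_mem_generated _⟩).2 (b p).2) hζ ?_
      (W.generates_generated _) hgen
    rw [h1]
    exact (stdOrthonormalBasis ℂ (W.vacuum p.1)).orthonormal.1 p.2
  -- The orthogonal complement of the sum is again a submodule, since the summands are stable under
  -- adjoints of morphisms. A vacuum vector in it would be orthogonal to a full orthonormal basis of
  -- the vacuum space it belongs to.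
  · let Y : W.Sub :=
      { space := fun n => (⨆ p, (W.generated (b p : W.space p.1.k)).space n)ᗮ
        map_mem := fun {m n} c x hx => by
          rw [← Submodule.iInf_orthogonal, Submodule.mem_iInf] at hx ⊢
          refine fun p => (Submodule.mem_orthogonal' _ _).2 fun y hy => ?_
          rw [W.inner_map]
          exact (Submodule.mem_orthogonal' _ _).1 (hx p) _
            ((W.generated (b p : W.space p.1.k)).map_mem _ hy) }
    have hY : ∀ n, Y.space n = ⊥ := by
      intro n
      induction n using Nat.strong_induction_on with
      | _ n ih =>
        by_contra hn
        obtain ⟨s, rfl, ξ, hξ, h1, hξY⟩ := exists_vacuum Y hn ih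
        have h0 : ∀ i, Inner.inner ℂ (b ⟨s, i⟩ : W.space s.k) ξ = 0 := fun i =>
          (Submodule.mem_orthogonal _ _).1 hξY _ (Submodule.mem_iSup_of_mem ⟨s, i⟩
            (W.self_mem_generated _))
        have h2 : (⟨ξ, hξ⟩ : W.vacuum s) = 0 := by
          rw [← (stdOrthonormalBasis ℂ (W.vacuum s)).sum_repr' ⟨ξ, hξ⟩]
          refine Finset.sum_eq_zero fun i _ => ?_
          exact (congrArg (· • _) (h0 i)).trans (zero_smul _ _)
        have h3 : ξ = 0 := congrArg Subtype.val h2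
        rw [h3, norm_zero] at h1
        exact zero_ne_one h1
    exact fun n => Submodule.orthogonal_eq_bot_iff.1 (hY n)

theorem existsUnique_isOrthogonalSum (hV : VacuumGenerated V) (W : HilbertModule.{u} AP) :
    ∃! mult : Label → ℕ, IsOrthogonalSum V W mult :=
  ⟨_, isOrthogonalSum_finrank_vacuum hV W, fun _ h => funext (mult_eq_finrank_vacuum hV h)⟩

theorem exists_iso_of_isIrreducible (hV : VacuumGenerated V) {W : HilbertModule.{u} AP}
    (hW : W.IsIrreducible)
    (hk : W.HasWeight k) : ∃ s : Label, s.k = k ∧ Nonempty (W.Iso (V s)) := by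
  let Y : W.Sub := ⟨fun _ => ⊤, fun _ _ _ => trivial⟩
  have hm : Y.space k ≠ ⊥ := fun e => by
    have := hk.1
    obtain ⟨x, hx⟩ := @exists_ne _ this (0 : W.space k)
    exact hx ((Submodule.mem_bot ℂ).1 (e ▸ Submodule.mem_top : x ∈ (⊥ : Submodule ℂ _)))
  have hlt : ∀ j < k, Y.space j = ⊥ := fun j hj => (Submodule.eq_bot_iff _).2 fun x _ => by
    by_contra hx
    exact absurd (hk.2 ⟨x, 0, hx⟩) (not_le.2 hj)
  obtain ⟨s, rfl, ξ, hξ, h1, -⟩ := exists_vacuum Y hm hlt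
  obtain ⟨ζ, hζ, h1', hgen⟩ := hV s
  refine ⟨s, rfl, nonempty_iso_of_generates hξ hζ (h1.trans h1'.symm) ?_ hgen⟩
  rcases hW.2 (W.generated ξ) with h | h
  · have h0 := W.self_mem_generated ξ
    rw [h, Submodule.mem_bot] at h0
    rw [h0, norm_zero] at h1
    exact absurd h1 zero_ne_one
  · exact fun m x => (h m).ge (Submodule.mem_top (x := x))

/-- An isomorphism carries the generating vacuum vector of label `s` into a module generated by one
of label `s'`. If the labels differ, the image is orthogonal to the whole module, itself included.
-/
theorem eq_of_nonempty_iso (hV : VacuumGenerated V) {s s' : Label} (h : Nonempty ((V s).Iso (V s'))) : s = s' := by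
  obtain ⟨e⟩ := h
  obtain ⟨ζ, hζ, h1, hgen⟩ := hV s
  obtain ⟨ζ', hζ', -, hgen'⟩ := hV s'
  by_contra hne
  obtain ⟨a, ha⟩ := hgen' s.k (e.equiv s.k ζ)
  have h0 := inner_map_map_eq_zero_of_ne hne (e.map_vacuum hζ) hζ' (AP.one _) a
  rw [ha, map_one_apply, inner_self_eq_zero, LinearIsometryEquiv.map_eq_zero_iff] at h0
  rw [h0, norm_zero] at h1
  exact zero_ne_one h1

end Decomposition

/-! ## Transport along an isomorphism of categories -/

section Pullback

variable {C D : LinearInvolutiveCat} {F : StarFunctor C D}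

/-- Pullback changes only the action and not the spaces, so pulling back along the inverse and then
along `F` returns `W` itself, not just an isomorphic module. -/
theorem exists_eq_pullback (hF : F.IsIso) (W : HilbertModule.{u} C) :
    ∃ W' : HilbertModule.{u} D, W'.pullback F = W := by
  refine ⟨W.pullback (F.inverse hF), ?_⟩
  have h : ∀ {m n : ℕ}, (W.map ∘ₗ (F.inverse hF).map) ∘ₗ F.map =
      (W.map : C.Hom m n →ₗ[ℂ] _) := fun {m n} => LinearMap.ext fun c =>
    congrArg W.map ((LinearEquiv.ofBijective F.map (hF m n)).symm_apply_apply c)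
  cases W
  simp only [pullback]
  congr
  funext m n
  exact h

/-- Submodules of a pullback along an isomorphism. -/
def Sub.ofPullback (hF : F.IsIso) {W : HilbertModule.{u} D} (X : (W.pullback F).Sub) : W.Sub where
  space := X.space
  map_mem {m n} c {ξ} h := by
    obtain ⟨c, rfl⟩ := (hF m n).2 c
    exact X.map_mem c h

/-- A submodule as a submodule of a pullback. -/
def Sub.pullback {W : HilbertModule.{u} D} (X : W.Sub) (F : StarFunctor C D) :
    (W.pullback F).Sub where
  space := X.space
  map_mem c _ h := X.map_mem (F.map c) h

theorem isIrreducible_pullback (hF : F.IsIso) {W : HilbertModule.{u} D} :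
    (W.pullback F).IsIrreducible ↔ W.IsIrreducible :=
  ⟨fun h => ⟨h.1, fun X => h.2 (X.pullback F)⟩,
    fun h => ⟨h.1, fun X => h.2 (X.ofPullback hF)⟩⟩

/-- An isomorphism of modules as an isomorphism of pullbacks. -/
def Iso.pullback {W : HilbertModule.{u} D} {V : HilbertModule.{v} D} (e : W.Iso V)
    (F : StarFunctor C D) : (W.pullback F).Iso (V.pullback F) where
  equiv := e.equiv
  natural c ξ := e.natural (F.map c) ξ

/-- An isomorphism of pullbacks along an isomorphism of categories. -/
def Iso.ofPullback (hF : F.IsIso) {W : HilbertModule.{u} D} {V : HilbertModule.{v} D}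
    (e : (W.pullback F).Iso (V.pullback F)) : W.Iso V where
  equiv := e.equiv
  natural {m n} c ξ := by
    obtain ⟨c, rfl⟩ := (hF m n).2 c
    exact e.natural c ξ

theorem nonempty_iso_pullback (hF : F.IsIso) {W : HilbertModule.{u} D} {V : HilbertModule.{v} D} :
    Nonempty ((W.pullback F).Iso (V.pullback F)) ↔ Nonempty (W.Iso V) :=
  ⟨fun ⟨e⟩ => ⟨e.ofPullback hF⟩, fun ⟨e⟩ => ⟨e.pullback F⟩⟩

theorem isOrthogonalSum_pullback (hF : F.IsIso) {ι : Type} {V : ι → HilbertModule.{u} D}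
    {W : HilbertModule.{v} D} {mult : ι → ℕ} :
    IsOrthogonalSum (fun s => (V s).pullback F) (W.pullback F) mult ↔
      IsOrthogonalSum V W mult := by
  constructor
  · rintro ⟨X, h1, h2, h3⟩
    exact ⟨fun p => (X p).ofPullback hF, fun p => (nonempty_iso_pullback hF).1 (h1 p), h2, h3⟩
  · rintro ⟨X, h1, h2, h3⟩
    exact ⟨fun p => (X p).pullback F, fun p => (nonempty_iso_pullback hF).2 (h1 p), h2, h3⟩

end Pullback

end HilbertModule

/-! ## The modules `V^{k,ω}` -/

section EigenProjection

variable {M : Type*} [AddCommGroup M] [Module ℂ M]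

/-- The sum of `ω⁻ʲ Rʲ` for `j < K`, a multiple of the projection onto the `ω`-eigenspace of an
endomorphism of order `K`. -/
def eigenSum (R : Module.End ℂ M) (ω : ℂ) (K : ℕ) : Module.End ℂ M :=
  ∑ j ∈ Finset.range K, (ω⁻¹) ^ j • R ^ j

/-- Up to the factor `ω`, applying `R` moves each summand to the next, and the summand for `j = K`
is again the one for `j = 0`. -/
theorem apply_eigenSum {R : Module.End ℂ M} {ω : ℂ} {K : ℕ} (hR : R ^ K = 1) (hω : ω ^ K = 1)
    (h0 : ω ≠ 0) (x : M) : R (eigenSum R ω K x) = ω • eigenSum R ω K x := by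
  have h := (Finset.sum_range_succ (fun j => (ω⁻¹) ^ j • (R ^ j) x) K).symm.trans
    (Finset.sum_range_succ' (fun j => (ω⁻¹) ^ j • (R ^ j) x) K)
  rw [hR, inv_pow, hω, pow_zero, pow_zero, inv_one, add_left_inj] at h
  simp only [eigenSum, LinearMap.sum_apply, LinearMap.smul_apply, map_sum]
  rw [h, Finset.smul_sum]
  refine Finset.sum_congr rfl fun j _ => ?_
  rw [map_smul, smul_smul, pow_succ, mul_comm, mul_assoc, inv_mul_cancel₀ h0, mul_one, pow_succ',
    Module.End.mul_apply]

theorem eigenSum_apply_of_eigen {R : Module.End ℂ M} {ω : ℂ} {K : ℕ} (h0 : ω ≠ 0) {x : M}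
    (hx : R x = ω • x) : eigenSum R ω K x = (K : ℂ) • x := by
  have h : ∀ j, (R ^ j) x = ω ^ j • x := fun j => by
    induction j with
    | zero => simp
    | succ j ih => rw [pow_succ, Module.End.mul_apply, hx, map_smul, ih, smul_smul, pow_succ']
  simp only [eigenSum, LinearMap.sum_apply, LinearMap.smul_apply, h, smul_smul, ← mul_pow,
    inv_mul_cancel₀ h0, one_pow, one_smul]
  simp [Nat.cast_smul_eq_nsmul]

end EigenProjection

/-! ### The generating vacuum vector of `V^{k,ω}` -/

section SimpleModule

variable {k m n : ℕ} (t : FaithfulTrace k)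

theorem internalRotation_pow_mk (j : ℕ) (a : AP.Hom k m) :
    (internalRotation t m ^ j) (mk t m a) =
      mk t m (AP.comp a (tangle (AnnularTangle.rotationPow k j))) := by
  induction j with
  | zero => exact (congrArg (mk t m) (AP.comp_one a)).symm
  | succ j ih =>
    rw [pow_succ', Module.End.mul_apply, ih, internalRotation_mk, AP.assoc, comp_tangle]
    have : (AnnularTangle.rotationPow k j).comp (rotation k) =
        AnnularTangle.rotationPow k (j + 1) := by
      rw [← AnnularTangle.rotationPow_comp]
      exact congrArg _ (tangleCat.comp_one (rotation k)).symm
    rw [this]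

/-- The order of the rotation on `[k]`. -/
def rotationOrder (k : ℕ) : ℕ := max k 1

theorem rotationPow_rotationOrder (k : ℕ) :
    AnnularTangle.rotationPow k (rotationOrder k) = AnnularTangle.one k := by
  cases k with
  | zero => exact AnnularTangle.ext_some fun i => i.elim0
  | succ k =>
    rw [rotationOrder, max_eq_left (Nat.succ_pos k)]
    exact AnnularTangle.rotationPow_self _

theorem internalRotation_pow_rotationOrder (m : ℕ) :
    internalRotation t m ^ rotationOrder k = 1 := by
  ext x
  obtain ⟨a, rfl⟩ := mk_surjective t x
  rw [internalRotation_pow_mk, rotationPow_rotationOrder]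
  exact congrArg (mk t m) (AP.comp_one a)

theorem Label.pow_rotationOrder (s : Label) : s.ω ^ rotationOrder s.k = 1 := by
  rcases Nat.eq_zero_or_pos s.k with h | h
  · rw [s.eq_one_of_zero h, one_pow]
  · rw [rotationOrder, max_eq_left h, s.pow_eq_one]

theorem Label.ω_ne_zero (s : Label) : s.ω ≠ 0 := by
  intro h
  have h1 := s.pow_rotationOrder
  rw [h, zero_pow (by simp [rotationOrder])] at h1
  exact zero_ne_one h1

theorem act_eigenSum (c : AP.Hom m n) (ω : ℂ) (K : ℕ) (x : QuotientSpace t m) :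
    act t c (eigenSum (internalRotation t m) ω K x) =
      eigenSum (internalRotation t n) ω K (act t c x) := by
  have h : ∀ (j : ℕ) y, act t c ((internalRotation t m ^ j) y) =
      (internalRotation t n ^ j) (act t c y) := fun j => by
    induction j with
    | zero => exact fun y => rfl
    | succ j ih =>
      intro y
      rw [pow_succ', Module.End.mul_apply, act_internalRotation, ih, pow_succ',
        Module.End.mul_apply]
  simp only [eigenSum, LinearMap.sum_apply, LinearMap.smul_apply, map_sum, map_smul, h]

theorem idCoeff_eq_zero_of_mem {a : AP.Hom k k} (ha : a ∈ AI k k) : idCoeff k a = 0 := by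
  induction ha using Submodule.span_induction with
  | zero => exact map_zero _
  | add a b _ _ ha hb => rw [map_add, ha, hb, add_zero]
  | smul z a _ ha => rw [map_smul, ha, smul_zero]
  | mem a ha =>
    obtain ⟨T, hT, rfl⟩ := ha
    rw [idCoeff_tangle, if_neg]
    rintro rfl
    simp [AnnularTangle.throughStrings, AnnularTangle.one] at hT

/-- The element is the class of `∑ ω⁻ʲ τʲ`. The coefficient of the identity vanishes on `AI k k`,
but here it is `1`, as `τʲ` is not the identity for `0 < j < k`. For `k = 0` the sum has the single
term `j = 0`. -/
theorem eigenSum_mk_one_ne_zero (ω : ℂ) :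
    eigenSum (internalRotation t k) ω (rotationOrder k) (mk t k (AP.one k)) ≠ 0 := by
  intro h
  simp only [eigenSum, LinearMap.sum_apply, LinearMap.smul_apply, internalRotation_pow_mk,
    AP.one_comp, ← map_smul, ← map_sum] at h
  have h1 := idCoeff_eq_zero_of_mem ((mk_eq_zero t).1 h)
  rw [map_sum, Finset.sum_eq_single 0] at h1
  · rw [map_smul, idCoeff_tangle, if_pos (AnnularTangle.rotationPow_zero k)] at h1
    simp at h1
  · intro j hj h0
    rw [map_smul, idCoeff_tangle, if_neg, smul_zero]
    have hj := Finset.mem_range.1 hj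
    rw [rotationOrder] at hj
    exact AnnularTangle.rotationPow_ne_one (Nat.pos_of_ne_zero h0) (by omega)
  · intro h0
    simp [rotationOrder] at h0

theorem quotientSpace_eq_zero (h : m < k) (x : QuotientSpace t m) : x = 0 := by
  obtain ⟨a, rfl⟩ := mk_surjective t x
  rw [mk_eq_zero]
  induction a using hom_induction with
  | zero => exact zero_mem _
  | add a b ha hb => exact add_mem ha hb
  | smul z T =>
    exact Submodule.smul_mem _ _ (tangle_mem_AI (T.throughStrings_le_right.trans_lt h))

/-- The module `V^{k,ω}` is generated by a vacuum vector. -/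
theorem exists_vacuum_simpleModule (tr : ∀ k, FaithfulTrace k) (s : Label) :
    ∃ ζ ∈ (simpleModule tr s).vacuum s, ‖ζ‖ = 1 ∧ (simpleModule tr s).Generates ζ := by
  let P (m : ℕ) := eigenSum (internalRotation (tr s.k) m) s.ω (rotationOrder s.k)
  have hP : ∀ m x, P m x ∈ rotationEigenspace (tr s.k) s.ω m := fun m x =>
    Module.End.mem_eigenspace_iff.2 (apply_eigenSum (internalRotation_pow_rotationOrder _ m)
      s.pow_rotationOrder s.ω_ne_zero x)
  let ζ : (simpleModule tr s).space s.k := ⟨P s.k (mk (tr s.k) s.k (AP.one s.k)), hP _ _⟩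
  have h0 : ζ ≠ 0 := fun h =>
    eigenSum_mk_one_ne_zero (tr s.k) s.ω (congrArg Subtype.val h)
  have hvac : ζ ∈ (simpleModule tr s).vacuum s := by
    refine ⟨fun j hj c => Subtype.ext (quotientSpace_eq_zero (tr s.k) hj _), Subtype.ext ?_⟩
    refine (act_eigenSum (tr s.k) (tangle (rotation s.k)) _ _ _).trans ?_
    -- On the class of `1`, composing with the rotation from the left is the same as the internal
    -- rotation, and this has eigenvalue `s.ω` on the image of `P`.
    rw [act_mk, AP.comp_one, ← AP.one_comp (tangle (rotation s.k)), ← internalRotation_mk,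
      ← Module.End.mul_apply]
    have hc : P s.k * internalRotation (tr s.k) s.k = internalRotation (tr s.k) s.k * P s.k :=
      (Commute.sum_left _ _ _ fun j _ =>
        ((Commute.refl (internalRotation (tr s.k) s.k)).pow_left j).smul_left _)
    exact (LinearMap.congr_fun hc _).trans (Module.End.mem_eigenspace_iff.1 (hP _ _))
  have hK : (rotationOrder s.k : ℂ) ≠ 0 := by simp [rotationOrder]
  have hgen : (simpleModule tr s).Generates ζ := by
    rintro m ⟨x, hx⟩
    obtain ⟨a, rfl⟩ := mk_surjective (tr s.k) x
    -- Acting by `a` on `P(1)` gives `P(a)`, which is the order of the rotation times `a` when the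
    -- class of `a` is already in the eigenspace.
    refine ⟨(rotationOrder s.k : ℂ)⁻¹ • a, ?_⟩
    rw [map_smul, LinearMap.smul_apply]
    refine Subtype.ext ?_
    change (rotationOrder s.k : ℂ)⁻¹ • act (tr s.k) a (P s.k (mk (tr s.k) s.k (AP.one s.k))) = _
    rw [act_eigenSum, act_mk, AP.comp_one,
      eigenSum_apply_of_eigen s.ω_ne_zero (Module.End.mem_eigenspace_iff.1 hx),
      inv_smul_smul₀ hK]
  have hn : ((‖ζ‖⁻¹ : ℝ) : ℂ) ≠ 0 := by simpa using h0
  refine ⟨((‖ζ‖⁻¹ : ℝ) : ℂ) • ζ, Submodule.smul_mem _ _ hvac, ?_, fun m x => ?_⟩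
  · rw [norm_smul]
    simp [norm_ne_zero_iff.2 h0]
  · obtain ⟨a, rfl⟩ := hgen m x
    refine ⟨((‖ζ‖⁻¹ : ℝ) : ℂ)⁻¹ • a, ?_⟩
    rw [map_smul, map_smul, LinearMap.smul_apply, smul_inv_smul₀ hn]

end SimpleModule

end GICAR

end

/-- Classification of the Hilbert modules over the annular planar rook category `AP` and over the
annular GICAR category `AG`, for any choice of faithful traces defining the inner products. -/
theorem mainTheorem6 (tr : ∀ k : ℕ, GICAR.FaithfulTrace k) :
    -- `V^{k,ω}` is irreducible of weight `k`, and `dim V^{k,ω}_m` is `0` if `m < k` and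
    -- `C(m, k)` if `m ≥ k`
    (∀ s : GICAR.Label,
      (GICAR.simpleModule tr s).IsIrreducible ∧
      (GICAR.simpleModule tr s).HasWeight s.k ∧
      (∀ m, m < s.k → Module.finrank ℂ ((GICAR.simpleModule tr s).space m) = 0) ∧
      (∀ m, s.k ≤ m → Module.finrank ℂ ((GICAR.simpleModule tr s).space m) = m.choose s.k)) ∧
    -- every irreducible Hilbert `AP`-module of weight `k` is isomorphic to some `V^{k,ω}`
    (∀ (k : ℕ) (W : GICAR.HilbertModule.{u} GICAR.AP), W.IsIrreducible → W.HasWeight k →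
      ∃ s : GICAR.Label, s.k = k ∧ Nonempty (W.Iso (GICAR.simpleModule tr s))) ∧
    -- the `V^{k,ω}` are pairwise non-isomorphic
    (∀ s s' : GICAR.Label,
      Nonempty ((GICAR.simpleModule tr s).Iso (GICAR.simpleModule tr s')) → s = s') ∧
    -- every Hilbert `AP`-module is an orthogonal sum of `V^{k,ω}`s, with unique multiplicities
    (∀ W : GICAR.HilbertModule.{u} GICAR.AP,
      ∃! mult : GICAR.Label → ℕ, GICAR.IsOrthogonalSum (GICAR.simpleModule tr) W mult) ∧
    -- `AG ≅ AP`
    GICAR.Psi.IsIso ∧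
    -- the same classification for `AG`
    (∀ s : GICAR.Label,
      ((GICAR.simpleModule tr s).pullback GICAR.Psi).IsIrreducible ∧
      ((GICAR.simpleModule tr s).pullback GICAR.Psi).HasWeight s.k) ∧
    (∀ (k : ℕ) (W : GICAR.HilbertModule.{u} GICAR.AG), W.IsIrreducible → W.HasWeight k →
      ∃ s : GICAR.Label, s.k = k ∧
        Nonempty (W.Iso ((GICAR.simpleModule tr s).pullback GICAR.Psi))) ∧
    (∀ s s' : GICAR.Label,
      Nonempty (((GICAR.simpleModule tr s).pullback GICAR.Psi).Iso
        ((GICAR.simpleModule tr s').pullback GICAR.Psi)) → s = s') ∧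
    (∀ W : GICAR.HilbertModule.{u} GICAR.AG,
      ∃! mult : GICAR.Label → ℕ,
        GICAR.IsOrthogonalSum (fun s => (GICAR.simpleModule tr s).pullback GICAR.Psi) W mult) := by
  have hP := GICAR.Psi_isIso
  have hV : GICAR.HilbertModule.VacuumGenerated (GICAR.simpleModule tr) :=
    GICAR.exists_vacuum_simpleModule tr
  have hsimple : ∀ s : GICAR.Label, (GICAR.simpleModule tr s).IsIrreducible ∧
      (GICAR.simpleModule tr s).HasWeight s.k := fun s => by
    obtain ⟨ζ, hζ, h1, hgen⟩ := hV s
    have h0 : ζ ≠ 0 := norm_ne_zero_iff.1 (h1 ▸ one_ne_zero)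
    exact ⟨GICAR.HilbertModule.isIrreducible hζ hgen h0,
      GICAR.HilbertModule.hasWeight hζ hgen h0⟩
  have hdim : ∀ (s : GICAR.Label) m,
      Module.finrank ℂ ((GICAR.simpleModule tr s).space m) = m.choose s.k := fun s m => by
    obtain ⟨ζ, hζ, h1, hgen⟩ := hV s
    exact GICAR.HilbertModule.finrank_space hζ hgen h1 m
  refine ⟨fun s => ⟨(hsimple s).1, (hsimple s).2,
      fun m hm => (hdim s m).trans (Nat.choose_eq_zero_of_lt hm), fun m _ => hdim s m⟩,
    fun k W hW hk => GICAR.HilbertModule.exists_iso_of_isIrreducible hV hW hk,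
    fun s s' => GICAR.HilbertModule.eq_of_nonempty_iso hV,
    GICAR.HilbertModule.existsUnique_isOrthogonalSum hV, hP,
    fun s => ⟨(GICAR.HilbertModule.isIrreducible_pullback hP).2 (hsimple s).1, (hsimple s).2⟩,
    fun k W hW hk => ?_,
    fun s s' h => GICAR.HilbertModule.eq_of_nonempty_iso hV
      ((GICAR.HilbertModule.nonempty_iso_pullback hP).1 h), fun W => ?_⟩
  -- Every Hilbert `AG`-module is a pullback along `Ψ`, so the statement reduces to the one for
  -- `AP`.
  · obtain ⟨W, rfl⟩ := GICAR.HilbertModule.exists_eq_pullback hP W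
    obtain ⟨s, hs, h⟩ := GICAR.HilbertModule.exists_iso_of_isIrreducible hV
      ((GICAR.HilbertModule.isIrreducible_pullback hP).1 hW) hk
    exact ⟨s, hs, (GICAR.HilbertModule.nonempty_iso_pullback hP).2 h⟩
  · obtain ⟨W, rfl⟩ := GICAR.HilbertModule.exists_eq_pullback hP W
    simp only [GICAR.HilbertModule.isOrthogonalSum_pullback hP]
    exact GICAR.HilbertModule.existsUnique_isOrthogonalSum hV W
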